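/- Consider stochastic linear bandits with parameter noise on the unit ball $\mathcal A=\{a\in\mathbb R^d:\|a\|_p\le 1\}$, where $p\in(1,2]$ and $\frac1p+\frac1q=1$ (so $q\ge 2$). For a fixed reward distribution $\nu$ on $\mathbb R^d$, in each round $t=1,\dots,T$ the learner chooses $a_t\in\mathcal A$ (possibly at random) on the basis of the previous actions and rewards, a vector $\theta_t\sim\nu$ is drawn independently of $a_t$ and of the past, and the learner observes only the reward $a_t^\top\theta_t$. Let $\theta^\star$ and $\Sigma$ be the mean and the covariance matrix of $\nu$, let $\sigma_q^2(\nu)=\bigl(\sum_{i=1}^d\Sigma_{ii}^{q/2}\bigr)^{2/q}$, let $a^\star\in\arg\max_{a\in\mathcal A}a^\top\theta^\star$, and let $\mathcal R_T=\sum_{t=1}^T(a^\star-a_t)^\top\theta^\star$. There is an absolute constant $k\in\mathbb N$ such that for every $s<1$ there is a constant $c>0$, depending only on $s$, with the following property. For all $p\in(1,2]$ with conjugate exponent $q$, all integers $T\ge d\ge 1$, all $\sigma^2>0$ and every (possibly randomized) bandit algorithm on $\mathcal A$, there is a reward distribution $\nu$ on $\mathbb R^d$ with finite second moments and $\sigma_q^2(\nu)=\sigma^2$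 such that $$\mathbb E[\mathcal R_T]\;\ge\; c\,\frac{\sqrt{dT\sigma^2}}{(1+\log T)^k},$$ that is, $\mathbb E[\mathcal R_T]=\widetilde\Omega\bigl(\sqrt{dT\sigma^2}\bigr)$. Moreover, if $\sigma^2\le s$, then $\nu$ can be chosen so that in addition the rewards are bounded: for $\nu$-almost every $\theta$, $|a^\top\theta|\le 1$ for all $a\in\mathcal A$. -/

import Mathlib

open MeasureTheory ProbabilityTheory
open scoped Matrix

/-- The closed unit ball of the `ℓ_p` norm on `ℝ^d`. -/
def lpUnitBall (d : ℕ) (p : ℝ) : Set (Fin d → ℝ) :=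
  {a | ‖WithLp.toLp (ENNReal.ofReal p) a‖ ≤ 1}

/-- A (possibly randomized) bandit algorithm with action set `A`: for every round `t`, a Markov
kernel which sends the history of the `t` previous actions and rewards to the law of the next
action. -/
structure BanditAlgorithm {d : ℕ} (A : Set (Fin d → ℝ)) where
  policy : (t : ℕ) → Kernel (Fin t → A × ℝ) A
  isMarkov : ∀ t, IsMarkovKernel (policy t)

/-- One round of the interaction in the parameter noise model: given the history, the learner draws
an action `a`, the environment independently draws `θ ∼ ν`, and the reward is `a ⬝ᵥ θ`. -/
noncomputable def roundKernel {d : ℕ} {A : Set (Fin d → ℝ)} (alg : BanditAlgorithm A)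
    (ν : Measure (Fin d → ℝ)) (t : ℕ) : Kernel (Fin t → A × ℝ) (A × ℝ) :=
  (alg.policy t ×ₖ Kernel.const (Fin t → A × ℝ) ν).map
    (fun x : A × (Fin d → ℝ) => (x.1, (x.1 : Fin d → ℝ) ⬝ᵥ x.2))

/-- The law of the actions and rewards of the first `t` rounds. -/
noncomputable def historyLaw {d : ℕ} {A : Set (Fin d → ℝ)} (alg : BanditAlgorithm A)
    (ν : Measure (Fin d → ℝ)) : (t : ℕ) → Measure (Fin t → A × ℝ)
  | 0 => Measure.dirac (fun i => i.elim0)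
  | t + 1 => (historyLaw alg ν t ⊗ₘ roundKernel alg ν t).map
      (fun x => Fin.snoc (α := fun _ => A × ℝ) x.1 x.2)

/-- The expectation `θ⋆` of the reward distribution. -/
noncomputable def meanVector {d : ℕ} (ν : Measure (Fin d → ℝ)) : Fin d → ℝ :=
  fun i => ∫ θ, θ i ∂ν

/-- The covariance matrix `Σ` of the reward distribution. -/
noncomputable def covMatrix {d : ℕ} (ν : Measure (Fin d → ℝ)) : Matrix (Fin d) (Fin d) ℝ :=
  Matrix.of fun i j => covariance (fun θ : Fin d → ℝ => θ i) (fun θ => θ j) ν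

/-- The quantity `σ_q² = (∑ i, Σ i i ^ (q / 2)) ^ (2 / q)`. -/
noncomputable def sigmaSq {d : ℕ} (q : ℝ) (ν : Measure (Fin d → ℝ)) : ℝ :=
  (∑ i, covMatrix ν i i ^ (q / 2)) ^ (2 / q)

/-- `aStar` is a best fixed action for the reward distribution `ν`. -/
def IsBestAction {d : ℕ} (A : Set (Fin d → ℝ)) (ν : Measure (Fin d → ℝ))
    (aStar : Fin d → ℝ) : Prop :=
  aStar ∈ A ∧ ∀ a ∈ A, a ⬝ᵥ meanVector ν ≤ aStar ⬝ᵥ meanVector ν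

/-- The expectation, over the interaction, of the pseudo-regret
`∑ t, (aStar - a_t) ⬝ᵥ θ⋆` over `T` rounds. -/
noncomputable def expectedRegret {d : ℕ} {A : Set (Fin d → ℝ)} (alg : BanditAlgorithm A)
    (ν : Measure (Fin d → ℝ)) (aStar : Fin d → ℝ) (T : ℕ) : ℝ :=
  ∫ h, ∑ t : Fin T, (aStar - ((h t).1 : Fin d → ℝ)) ⬝ᵥ meanVector ν ∂(historyLaw alg ν T)

/-! The reward vector is `θ i = m i + u * z + τ * x i`, with `z` a random sign shared by all
coordinates and the `x i` independent truncated standard Gaussians. Suppose first that they are not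
truncated. Given `z`, the reward of `a` is Gaussian with variance `τ² ‖a‖₂²`, so changing `m` by
`±Δ` in coordinate `i` alone yields a divergence of at most `a i² Δ² / (2 τ² ‖a‖₂²)`. Summed over
`i` this is at most `Δ² / (2 τ²)`, whatever the action: each round has a fixed budget of information
shared by all `d` coordinates (`sum_klDiv_historyLaw_single_le`). With `Δ = (τ / 8) √(d / T)`, the
`T` rounds reveal on average at most `1 / 128` per coordinate, which is too little to identify its
sign or to locate a single nonzero coordinate.

Two families of means convert this ignorance into regret, with target order `Δ T d^(1/q)`. If all
coordinates are `±Δ`, an action with `n` correct signs earns at most `Δ n^(1/q)` by Hölder, and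
concavity shows that it loses a fraction at least `(1 - n / d) / q` of the optimum `Δ d^(1/q)`. The
factor `1 / q` costs only a logarithm when `q ≤ 2 (1 + log T)`. For larger `q`, `d^(1/q) ≤ 2`, and
it suffices to hide one nonzero coordinate: since `p ≤ 2`, an action cannot have two entries of
absolute value at least `3/4`. In both families an average over the candidate means selects a bad
one.

The noise is split in two because the rewards must be bounded even for `σ²` close to 1. A random
sign attains its variance with the smallest possible range, so it carries most of the variance, and
revealing it to the learner gives an upper bound on the divergence. The Gaussian part hides the
mean; its range `τ L` is a small multiple `κ` of the target standard deviation `ρ`. Truncating at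
`L` of order `√(log T)` costs one logarithmic factor in `τ` and, by domination of densities, only a
factor `10/9` in the probability of any event (`historyLaw_truncGaussian_real_le`). All information
bounds are therefore proved for genuine Gaussians and then transferred. -/

/-! ### Divergence: disintegration, change of measure, Gaussian case -/

section InformationInequalities

open InformationTheory

variable {α β γ : Type*} {mα : MeasurableSpace α} {mβ : MeasurableSpace β} {mγ : MeasurableSpace γ}

/-- The conditional divergence of two kernels is the average of their pointwise divergences. -/
lemma klDiv_compProd_eq_lintegral [MeasurableSpace.CountableOrCountablyGenerated α β]
    (μ : Measure α) [IsFiniteMeasure μ] (κ η : Kernel α β) [IsMarkovKernel κ] [IsMarkovKernel η]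
    (h : ∀ a, κ a ≪ η a) :
    klDiv (μ ⊗ₘ κ) (μ ⊗ₘ η) = ∫⁻ a, klDiv (κ a) (η a) ∂μ := by
  have hac : μ ⊗ₘ κ ≪ μ ⊗ₘ η := Measure.AbsolutelyContinuous.compProd_right (.of_forall h)
  have hm : Measurable (Function.uncurry (Kernel.rnDeriv κ η)) := Kernel.measurable_rnDeriv κ η
  have hκ : η.withDensity (Kernel.rnDeriv κ η) = κ := by
    ext1 a
    rw [Kernel.withDensity_apply _ hm,
      withDensity_congr_ae Kernel.rnDeriv_eq_rnDeriv_measure, Measure.withDensity_rnDeriv_eq _ _ (h a)]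
  have : IsSFiniteKernel (η.withDensity (Kernel.rnDeriv κ η)) := by rw [hκ]; infer_instance
  have hd : μ ⊗ₘ κ = (μ ⊗ₘ η).withDensity (Function.uncurry (Kernel.rnDeriv κ η)) := by
    conv_lhs => rw [← hκ]
    exact Measure.compProd_withDensity hm
  -- Both composition products share the first marginal, so their density is the fibrewise one and
  -- Fubini applies.
  have hr : (μ ⊗ₘ κ).rnDeriv (μ ⊗ₘ η) =ᵐ[μ ⊗ₘ η] Function.uncurry (Kernel.rnDeriv κ η) := by
    rw [hd]
    exact Measure.rnDeriv_withDensity _ hm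
  rw [klDiv_eq_lintegral_klFun_of_ac hac]
  have hmk : Measurable fun x : α × β =>
      ENNReal.ofReal (klFun (Function.uncurry (Kernel.rnDeriv κ η) x).toReal) :=
    (measurable_klFun.comp hm.ennreal_toReal).ennreal_ofReal
  calc ∫⁻ x, ENNReal.ofReal (klFun ((μ ⊗ₘ κ).rnDeriv (μ ⊗ₘ η) x).toReal) ∂(μ ⊗ₘ η)
      = ∫⁻ x, ENNReal.ofReal (klFun (Function.uncurry (Kernel.rnDeriv κ η) x).toReal)
          ∂(μ ⊗ₘ η) := lintegral_congr_ae (by filter_upwards [hr] with x hx; rw [hx])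
    _ = ∫⁻ a, ∫⁻ b, ENNReal.ofReal (klFun (Kernel.rnDeriv κ η a b).toReal) ∂(η a) ∂μ :=
        Measure.lintegral_compProd hmk
    _ = ∫⁻ a, klDiv (κ a) (η a) ∂μ := by
        refine lintegral_congr fun a => ?_
        rw [klDiv_eq_lintegral_klFun_of_ac (h a)]
        refine lintegral_congr_ae ?_
        filter_upwards [Kernel.rnDeriv_eq_rnDeriv_measure (κ := κ) (η := η) (a := a)] with b hb
        rw [hb]

/-- Joint randomization `(z, x) ↦ (z, f z x)` viewed as a composition product. -/
lemma map_prod_graph_eq_compProd (α₀ : Measure α) [SFinite α₀] (ν : Measure β)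
    [IsProbabilityMeasure ν] {f : α × β → γ} (hf : Measurable f) :
    (α₀.prod ν).map (fun x => (x.1, f x)) =
      α₀ ⊗ₘ ((Kernel.id : Kernel α α)
        ×ₖ Kernel.const α ν).map f := by
  have hg : Measurable fun x : α × β => (x.1, f x) := by fun_prop
  ext s hs
  rw [Measure.map_apply hg hs, Measure.prod_apply (hg hs), Measure.compProd_apply hs]
  refine lintegral_congr fun a => ?_
  have hs' : MeasurableSet (Prod.mk a ⁻¹' s) := measurable_prodMk_left hs
  rw [Kernel.map_apply' _ hf _ hs', Kernel.prod_apply, Kernel.const_apply]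
  rw [Kernel.id_apply, Measure.dirac_prod, Measure.map_apply measurable_prodMk_left (hf hs')]
  rfl

/-- Convexity of the divergence: revealing the common randomness `z` cannot decrease it. -/
lemma klDiv_map_prod_graph_le [MeasurableSpace.CountableOrCountablyGenerated α γ]
    (α₀ : Measure α) [IsFiniteMeasure α₀] (ν ν' : Measure β) [IsProbabilityMeasure ν]
    [IsProbabilityMeasure ν'] {f g : α × β → γ} (hf : Measurable f) (hg : Measurable g)
    (h : ∀ z, ν.map (fun x => f (z, x)) ≪ ν'.map (fun x => g (z, x))) :
    klDiv ((α₀.prod ν).map fun x => (x.1, f x)) ((α₀.prod ν').map fun x => (x.1, g x)) ≤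
      ∫⁻ z, klDiv (ν.map fun x => f (z, x)) (ν'.map fun x => g (z, x)) ∂α₀ := by
  have key : ∀ (ρ : Measure β) [IsProbabilityMeasure ρ] {k : α × β → γ}, Measurable k → ∀ z,
      ((Kernel.id : Kernel α α)
        ×ₖ Kernel.const α ρ).map k z = ρ.map fun x => k (z, x) := by
    intro ρ _ k hk z
    rw [Kernel.map_apply _ hk, Kernel.prod_apply, Kernel.const_apply]
    rw [Kernel.id_apply, Measure.dirac_prod, Measure.map_map hk measurable_prodMk_left]
    rfl
  rw [map_prod_graph_eq_compProd α₀ ν hf, map_prod_graph_eq_compProd α₀ ν' hg]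
  have := Kernel.IsMarkovKernel.map
    ((Kernel.id : Kernel α α)
        ×ₖ Kernel.const α ν) hf
  have := Kernel.IsMarkovKernel.map
    ((Kernel.id : Kernel α α)
        ×ₖ Kernel.const α ν') hg
  rw [klDiv_compProd_eq_lintegral]
  · refine le_of_eq (lintegral_congr fun z => ?_)
    rw [key ν hf, key ν' hg]
  · intro z
    rw [key ν hf, key ν' hg]
    exact h z

/-- The pointwise form of "squared Hellinger distance is at most divergence": apply `1 - 1 / y ≤ log
y` at `y = √x`. -/
lemma sq_one_sub_sqrt_le_klFun {x : ℝ} (hx : 0 ≤ x) : (1 - √x) ^ 2 ≤ klFun x := by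
  rcases hx.eq_or_lt with rfl | hx
  · simp [klFun]
  have hs : 0 < √x := Real.sqrt_pos.2 hx
  have h1 : Real.log x = 2 * Real.log √x := by
    conv_lhs => rw [← Real.sq_sqrt hx.le]
    rw [Real.log_pow]; norm_num
  have h2 : 1 - (√x)⁻¹ ≤ Real.log √x := Real.one_sub_inv_le_log_of_pos hs
  have h3 : x * (1 - (√x)⁻¹) = x - √x := by
    rw [mul_sub, mul_one, ← div_eq_mul_inv, Real.div_sqrt]
  have h4 := mul_le_mul_of_nonneg_left h2 hx.le
  rw [klFun_apply, h1]
  have h5 := Real.sq_sqrt hx.le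
  nlinarith

/-- With `y = √x`, the Hellinger bound reduces this to `(4 y - 5)² ≥ 0`. The factor `5/4` is near
enough to 1 that an event of probability `1/2` stays bounded away from certainty after a change of
measure. -/
lemma le_add_klFun {x : ℝ} (hx : 0 ≤ x) : x ≤ 5 / 4 + 5 * klFun x := by
  have h := sq_one_sub_sqrt_le_klFun hx
  have h5 := Real.sq_sqrt hx
  nlinarith [sq_nonneg (4 * √x - 5)]

lemma one_le_add_klFun {x : ℝ} (hx : 0 ≤ x) : 1 ≤ 5 / 4 * x + 5 * klFun x := by
  have h := sq_one_sub_sqrt_le_klFun hx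
  have h5 := Real.sq_sqrt hx
  nlinarith [sq_nonneg (5 * √x - 4)]

/-- A change-of-measure inequality for a fixed event. -/
lemma measure_le_add_klDiv (μ ν : Measure α) [IsFiniteMeasure μ] [IsFiniteMeasure ν]
    (s : Set α) : μ s ≤ ENNReal.ofReal (5 / 4) * ν s + 5 * klDiv μ ν := by
  by_cases hac : μ ≪ ν
  swap
  · simp [klDiv_of_not_ac hac]
  rw [klDiv_eq_lintegral_klFun_of_ac hac]
  calc μ s = ∫⁻ x in s, μ.rnDeriv ν x ∂ν := by
        rw [Measure.setLIntegral_rnDeriv hac]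
    _ ≤ ∫⁻ x in s, (ENNReal.ofReal (5 / 4) +
          5 * ENNReal.ofReal (klFun (μ.rnDeriv ν x).toReal)) ∂ν := by
        refine lintegral_mono_ae (ae_restrict_of_ae ?_)
        filter_upwards [μ.rnDeriv_ne_top ν] with x hx
        rw [← ENNReal.ofReal_toReal hx, ← ENNReal.ofReal_ofNat 5,
          ← ENNReal.ofReal_mul (by norm_num), ← ENNReal.ofReal_add (by norm_num)
            (mul_nonneg (by norm_num) (klFun_nonneg ENNReal.toReal_nonneg)),
          ENNReal.toReal_ofReal ENNReal.toReal_nonneg]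
        exact ENNReal.ofReal_le_ofReal (le_add_klFun ENNReal.toReal_nonneg)
    _ = ENNReal.ofReal (5 / 4) * ν s +
          5 * ∫⁻ x in s, ENNReal.ofReal (klFun (μ.rnDeriv ν x).toReal) ∂ν := by
        rw [lintegral_add_left measurable_const, setLIntegral_const,
          lintegral_const_mul _ (by fun_prop)]
    _ ≤ _ := by gcongr; exact Measure.restrict_le_self

/-- A change-of-measure inequality for a fixed event, in the reverse direction. -/
lemma measure_le_add_klDiv' (μ ν : Measure α) [IsFiniteMeasure μ] [IsFiniteMeasure ν]
    (s : Set α) : ν s ≤ ENNReal.ofReal (5 / 4) * μ s + 5 * klDiv μ ν := by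
  by_cases hac : μ ≪ ν
  swap
  · simp [klDiv_of_not_ac hac]
  rw [klDiv_eq_lintegral_klFun_of_ac hac]
  calc ν s = ∫⁻ x in s, 1 ∂ν := by simp
    _ ≤ ∫⁻ x in s, (ENNReal.ofReal (5 / 4) * μ.rnDeriv ν x +
          5 * ENNReal.ofReal (klFun (μ.rnDeriv ν x).toReal)) ∂ν := by
        refine lintegral_mono_ae (ae_restrict_of_ae ?_)
        filter_upwards [μ.rnDeriv_ne_top ν] with x hx
        have h0 := klFun_nonneg (ENNReal.toReal_nonneg (a := μ.rnDeriv ν x))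
        have h1 := ENNReal.toReal_nonneg (a := μ.rnDeriv ν x)
        conv_rhs => rw [← ENNReal.ofReal_toReal hx]
        rw [← ENNReal.ofReal_ofNat 5, ENNReal.toReal_ofReal ENNReal.toReal_nonneg,
          ← ENNReal.ofReal_mul (by norm_num), ← ENNReal.ofReal_mul (by norm_num),
          ← ENNReal.ofReal_add (by positivity) (by positivity), ← ENNReal.ofReal_one]
        exact ENNReal.ofReal_le_ofReal (one_le_add_klFun ENNReal.toReal_nonneg)
    _ = ENNReal.ofReal (5 / 4) * μ s +
          5 * ∫⁻ x in s, ENNReal.ofReal (klFun (μ.rnDeriv ν x).toReal) ∂ν := by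
        rw [lintegral_add_left (by fun_prop), lintegral_const_mul _ (by fun_prop),
          Measure.setLIntegral_rnDeriv hac, lintegral_const_mul _ (by fun_prop)]
    _ ≤ _ := by gcongr; exact Measure.restrict_le_self

/-- The divergence of two Gaussian measures with the same variance. -/
lemma klDiv_gaussianReal_le (m m' : ℝ) (v : NNReal) (h : v = 0 → m = m') :
    klDiv (gaussianReal m v) (gaussianReal m' v) ≤ ENNReal.ofReal ((m - m') ^ 2 / (2 * v)) := by
  rcases eq_or_ne v 0 with hv | hv
  · rw [h hv, klDiv_self]; exact zero_le
  have hac : gaussianReal m v ≪ gaussianReal m' v :=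
    (gaussianReal_absolutelyContinuous m hv).trans (gaussianReal_absolutelyContinuous' m' hv)
  have hv' : (0 : ℝ) < v := lt_of_le_of_ne v.2 (fun h => hv (NNReal.eq h.symm))
  have hllr : llr (gaussianReal m v) (gaussianReal m' v) =ᵐ[gaussianReal m v]
      fun x => ((m - m') / v) * x + (m' ^ 2 - m ^ 2) / (2 * v) := by
    have h1 := Measure.rnDeriv_eq_div (μ := gaussianReal m v) (ν := gaussianReal m' v) (ξ := volume)
      (gaussianReal_absolutelyContinuous m hv) (gaussianReal_absolutelyContinuous m' hv)
    have h2 := rnDeriv_gaussianReal m v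
    have h3 := rnDeriv_gaussianReal m' v
    have hv0 := gaussianReal_absolutelyContinuous m hv
    filter_upwards [hac.ae_le h1, hv0.ae_le h2, hv0.ae_le h3] with x h1 h2 h3
    rw [llr, h1, h2, h3, ENNReal.toReal_div, toReal_gaussianPDF, toReal_gaussianPDF,
      gaussianPDFReal, gaussianPDFReal, mul_div_mul_left _ _ (by positivity), ← Real.exp_sub,
      Real.log_exp]
    field_simp
    ring
  have hid : Integrable (fun x : ℝ => x) (gaussianReal m v) :=
    memLp_one_iff_integrable.1 (memLp_id_gaussianReal 1)
  have hint : Integrable (llr (gaussianReal m v) (gaussianReal m' v)) (gaussianReal m v) := by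
    rw [integrable_congr hllr]
    exact (hid.const_mul _).add (integrable_const _)
  have hne := klDiv_ne_top hac hint
  rw [← ENNReal.ofReal_toReal hne, toReal_klDiv_of_measure_eq hac (by simp)]
  refine ENNReal.ofReal_le_ofReal (le_of_eq ?_)
  rw [integral_congr_ae hllr, integral_add (hid.const_mul _) (integrable_const _),
    integral_const_mul, integral_id_gaussianReal]
  simp only [integral_const, probReal_univ, smul_eq_mul, one_mul]
  field_simp
  ring

end InformationInequalities

/-! ### Chain rule and domination for the law of the history -/

section HistoryLaw

open InformationTheory

variable {d : ℕ} {A : Set (Fin d → ℝ)}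

lemma measurable_dotProduct_right (a : Fin d → ℝ) : Measurable fun x : Fin d → ℝ => a ⬝ᵥ x := by
  unfold dotProduct; fun_prop

lemma measurable_action_dotProduct :
    Measurable fun x : A × (Fin d → ℝ) => (x.1 : Fin d → ℝ) ⬝ᵥ x.2 := by
  unfold dotProduct
  refine Finset.measurable_sum _ fun i _ => ?_
  exact ((measurable_pi_apply i).comp (measurable_subtype_coe.comp measurable_fst)).mul
    ((measurable_pi_apply i).comp measurable_snd)

lemma measurable_snoc (t : ℕ) : Measurable
    (fun x : (Fin t → A × ℝ) × (A × ℝ) => (Fin.snoc (α := fun _ => A × ℝ) x.1 x.2 : Fin (t + 1) → A × ℝ)) := by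
  refine measurable_pi_lambda _ fun i => ?_
  refine Fin.lastCases ?_ (fun j => ?_) i
  · simpa using measurable_snd
  · simp only [Fin.snoc_castSucc]
    exact (measurable_pi_apply j).comp measurable_fst

instance roundKernel.instIsMarkovKernel (alg : BanditAlgorithm A) (ν : Measure (Fin d → ℝ))
    [IsProbabilityMeasure ν] (t : ℕ) : IsMarkovKernel (roundKernel alg ν t) := by
  have := alg.isMarkov t
  exact Kernel.IsMarkovKernel.map _ (measurable_fst.prodMk measurable_action_dotProduct)

lemma roundKernel_apply (alg : BanditAlgorithm A) (ν : Measure (Fin d → ℝ))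
    [IsProbabilityMeasure ν] (t : ℕ) (h : Fin t → A × ℝ) :
    roundKernel alg ν t h = ((alg.policy t h).prod ν).map
      (fun x => (x.1, (x.1 : Fin d → ℝ) ⬝ᵥ x.2)) := by
  have := alg.isMarkov t
  rw [roundKernel, Kernel.map_apply _ (measurable_fst.prodMk measurable_action_dotProduct),
    Kernel.prod_apply, Kernel.const_apply]

instance historyLaw.instIsProbabilityMeasure (alg : BanditAlgorithm A) (ν : Measure (Fin d → ℝ))
    [IsProbabilityMeasure ν] (t : ℕ) : IsProbabilityMeasure (historyLaw alg ν t) := by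
  induction t with
  | zero => unfold historyLaw; infer_instance
  | succ t ih =>
    unfold historyLaw
    exact Measure.isProbabilityMeasure_map (measurable_snoc t).aemeasurable

/-- The divergence of two history laws is at most the cumulated expected divergence of the
rewards. -/
lemma klDiv_historyLaw_le (alg : BanditAlgorithm A) (ν ν' : Measure (Fin d → ℝ))
    [IsProbabilityMeasure ν] [IsProbabilityMeasure ν']
    (hac : ∀ a ∈ A, ν.map (fun θ => a ⬝ᵥ θ) ≪ ν'.map (fun θ => a ⬝ᵥ θ)) (T : ℕ) :
    klDiv (historyLaw alg ν T) (historyLaw alg ν' T) ≤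
      ∑ t ∈ Finset.range T, ∫⁻ h, ∫⁻ a, klDiv (ν.map (fun θ => (a : Fin d → ℝ) ⬝ᵥ θ))
        (ν'.map (fun θ => (a : Fin d → ℝ) ⬝ᵥ θ)) ∂(alg.policy t h) ∂(historyLaw alg ν t) := by
  induction T with
  | zero => simp [historyLaw]
  | succ T ih =>
    have := alg.isMarkov T
    have hpt : ∀ h, klDiv (roundKernel alg ν T h) (roundKernel alg ν' T h) ≤
        ∫⁻ a, klDiv (ν.map (fun θ => (a : Fin d → ℝ) ⬝ᵥ θ))
          (ν'.map (fun θ => (a : Fin d → ℝ) ⬝ᵥ θ)) ∂(alg.policy T h) := by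
      intro h
      rw [roundKernel_apply, roundKernel_apply]
      exact klDiv_map_prod_graph_le _ _ _ measurable_action_dotProduct
        measurable_action_dotProduct fun a => hac a a.2
    have hach : ∀ h, roundKernel alg ν T h ≪ roundKernel alg ν' T h := by
      intro h
      rw [roundKernel_apply, roundKernel_apply]
      rw [map_prod_graph_eq_compProd _ _ measurable_action_dotProduct,
        map_prod_graph_eq_compProd _ _ measurable_action_dotProduct]
      have := Kernel.IsMarkovKernel.map ((Kernel.id : Kernel A A) ×ₖ Kernel.const A ν')
        measurable_action_dotProduct
      refine Measure.AbsolutelyContinuous.compProd_right (.of_forall fun a => ?_)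
      rw [Kernel.map_apply _ measurable_action_dotProduct,
        Kernel.map_apply _ measurable_action_dotProduct, Kernel.prod_apply, Kernel.prod_apply,
        Kernel.const_apply, Kernel.const_apply, Kernel.id_apply, Measure.dirac_prod,
        Measure.dirac_prod, Measure.map_map measurable_action_dotProduct measurable_prodMk_left,
        Measure.map_map measurable_action_dotProduct measurable_prodMk_left]
      exact hac a a.2
    rw [Finset.sum_range_succ]
    calc klDiv (historyLaw alg ν (T + 1)) (historyLaw alg ν' (T + 1))
        ≤ klDiv (historyLaw alg ν T ⊗ₘ roundKernel alg ν T)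
            (historyLaw alg ν' T ⊗ₘ roundKernel alg ν' T) := by
          rw [historyLaw, historyLaw]
          exact klDiv_map_le _ _ (measurable_snoc T)
      _ = klDiv (historyLaw alg ν T) (historyLaw alg ν' T) +
            ∫⁻ h, klDiv (roundKernel alg ν T h) (roundKernel alg ν' T h) ∂(historyLaw alg ν T) := by
          -- The chain rule averages the new divergence under the first law only; the policy is
          -- common to both, so only the reward contributes.
          rw [klDiv_compProd_eq_add, klDiv_compProd_eq_lintegral _ _ _ hach]
      _ ≤ _ := by
          gcongr with h
          exact hpt h

/-- Domination of reward distributions carries over to history laws. -/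
lemma historyLaw_le_smul (alg : BanditAlgorithm A) (ν ν' : Measure (Fin d → ℝ))
    [IsProbabilityMeasure ν] [IsProbabilityMeasure ν'] {c : ENNReal} (h : ν ≤ c • ν') (T : ℕ) :
    historyLaw alg ν T ≤ c ^ T • historyLaw alg ν' T := by
  induction T with
  | zero => simp [historyLaw]
  | succ T ih =>
    have := alg.isMarkov T
    have hg : Measurable fun x : A × (Fin d → ℝ) => (x.1, (x.1 : Fin d → ℝ) ⬝ᵥ x.2) :=
      measurable_fst.prodMk measurable_action_dotProduct
    have hr : ∀ h s, MeasurableSet s →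
        roundKernel alg ν T h s ≤ c * roundKernel alg ν' T h s := by
      intro h' s hs
      rw [roundKernel_apply, roundKernel_apply, Measure.map_apply hg hs, Measure.map_apply hg hs,
        Measure.prod_apply (hg hs), Measure.prod_apply (hg hs),
        ← lintegral_const_mul _ (measurable_measure_prodMk_left (hg hs))]
      exact lintegral_mono fun a => h _
    refine Measure.le_iff.2 fun s hs => ?_
    have hs' := measurable_snoc (A := A) T hs
    rw [historyLaw, historyLaw, Measure.map_apply (measurable_snoc T) hs, Measure.smul_apply,
      Measure.map_apply (measurable_snoc T) hs, Measure.compProd_apply hs',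
      Measure.compProd_apply hs', smul_eq_mul, pow_succ, mul_assoc]
    calc _ ≤ ∫⁻ h, c * roundKernel alg ν' T h (Prod.mk h ⁻¹' _) ∂(historyLaw alg ν T) :=
          lintegral_mono fun h => hr _ _ (measurable_prodMk_left hs')
      _ ≤ ∫⁻ h, c * roundKernel alg ν' T h (Prod.mk h ⁻¹' _) ∂(c ^ T • historyLaw alg ν' T) :=
          lintegral_mono' ih le_rfl
      _ = _ := by
          rw [lintegral_smul_measure, lintegral_const_mul _
            (Kernel.measurable_kernel_prodMk_left hs'), smul_eq_mul]

end HistoryLaw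

/-! ### Sign plus Gaussian noise, and its information budget -/

section NoiseModel

open InformationTheory

variable {d : ℕ}

/-- The uniform distribution on `{1, -1}`. -/
noncomputable def signLaw : Measure ℝ :=
  (2⁻¹ : ENNReal) • Measure.dirac 1 + (2⁻¹ : ENNReal) • Measure.dirac (-1)

instance signLaw.instIsProbabilityMeasure : IsProbabilityMeasure signLaw :=
  ⟨by simp [signLaw, ENNReal.inv_two_add_inv_two]⟩

/-- The distribution of `m i + u * z + τ * x i`, where `z` is a random sign common to all
coordinates and the `x i` are independent with distribution `γ`. -/
noncomputable def noisyLaw (γ : Measure ℝ) (u τ : ℝ) (m : Fin d → ℝ) : Measure (Fin d → ℝ) :=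
  (signLaw.prod (Measure.pi fun _ : Fin d => γ)).map fun x i => m i + u * x.1 + τ * x.2 i

lemma measurable_noisyLaw_map (u τ : ℝ) (m : Fin d → ℝ) :
    Measurable fun (x : ℝ × (Fin d → ℝ)) i => m i + u * x.1 + τ * x.2 i := by fun_prop

instance noisyLaw.instIsProbabilityMeasure (γ : Measure ℝ) [IsProbabilityMeasure γ] (u τ : ℝ)
    (m : Fin d → ℝ) : IsProbabilityMeasure (noisyLaw γ u τ m) :=
  Measure.isProbabilityMeasure_map (measurable_noisyLaw_map u τ m).aemeasurable

/-- An affine function of independent standard Gaussians is Gaussian. -/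
lemma map_pi_gaussianReal_affine (c : ℝ) (b : Fin d → ℝ) :
    (Measure.pi fun _ : Fin d => gaussianReal 0 1).map (fun x => c + ∑ i, b i * x i) =
      gaussianReal c (∑ i, b i ^ 2).toNNReal := by
  have hm : ∀ i : Fin d, (Measure.pi fun _ : Fin d => gaussianReal 0 1).map (fun x => b i * x i) =
      gaussianReal 0 (.mk (b i ^ 2) (sq_nonneg _)) := by
    intro i
    have h1 : (Measure.pi fun _ : Fin d => gaussianReal 0 1).map (fun x => x i) =
        gaussianReal 0 1 := (measurePreserving_eval (fun _ : Fin d => gaussianReal 0 1) i).map_eq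
    have h2 := gaussianReal_map_const_mul (μ := 0) (v := 1) (b i)
    rw [← h1, Measure.map_map (by fun_prop) (by fun_prop)] at h2
    simpa [Function.comp_def] using h2
  have hind : iIndepFun (fun (i : Fin d) (x : Fin d → ℝ) => b i * x i)
      (Measure.pi fun _ : Fin d => gaussianReal 0 1) :=
    iIndepFun_pi (X := fun i x => b i * x) fun i => (measurable_id.const_mul (b i)).aemeasurable
  have hsum : (Measure.pi fun _ : Fin d => gaussianReal 0 1).map (fun x => ∑ i, b i * x i) =
      gaussianReal 0 (∑ i, b i ^ 2).toNNReal := by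
    have : (fun x : Fin d → ℝ => ∑ i, b i * x i) = ∑ i, fun x : Fin d → ℝ => b i * x i := by
      ext x; simp
    rw [this]
    have : IsProbabilityMeasure ((Measure.pi fun _ : Fin d => gaussianReal 0 1).map
        (∑ i, fun x : Fin d → ℝ => b i * x i)) :=
      Measure.isProbabilityMeasure_map (by fun_prop)
    refine Measure.ext_of_charFun ?_
    rw [iIndepFun.charFun_map_sum_eq_prod
      (fun i => ((measurable_pi_apply i).const_mul (b i)).aemeasurable) hind]
    ext t
    simp only [Finset.prod_apply, hm, charFun_gaussianReal]
    rw [← Complex.exp_sum, Real.coe_toNNReal _ (Finset.sum_nonneg fun i _ => sq_nonneg _)]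
    congr 1
    push_cast
    simp [Finset.sum_mul, Finset.sum_div]
  have h3 := gaussianReal_map_const_add (μ := 0) (v := (∑ i, b i ^ 2).toNNReal) c
  rw [← hsum, Measure.map_map (by fun_prop) (by fun_prop)] at h3
  simpa [Function.comp_def] using h3

/-- The divergence of the rewards of an action under two Gaussian noise models. -/
lemma klDiv_reward_noisyLaw_le (u τ : ℝ) (hτ : 0 < τ) (m m' a : Fin d → ℝ) :
    klDiv ((noisyLaw (gaussianReal 0 1) u τ m).map fun θ => a ⬝ᵥ θ)
        ((noisyLaw (gaussianReal 0 1) u τ m').map fun θ => a ⬝ᵥ θ) ≤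
      ENNReal.ofReal ((a ⬝ᵥ (m - m')) ^ 2 / (2 * τ ^ 2 * ∑ i, a i ^ 2)) := by
  set f : (Fin d → ℝ) → ℝ × (Fin d → ℝ) → ℝ :=
    fun m x => (a ⬝ᵥ m + u * x.1 * ∑ i, a i) + ∑ i, (τ * a i) * x.2 i with hf
  have hfm : ∀ m, Measurable (f m) := fun m => by rw [hf]; fun_prop
  have hmap : ∀ m, (noisyLaw (gaussianReal 0 1) u τ m).map (fun θ => a ⬝ᵥ θ) =
      ((signLaw.prod (Measure.pi fun _ : Fin d => gaussianReal 0 1)).map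
        (fun x => (x.1, f m x))).map Prod.snd := by
    intro m
    rw [noisyLaw, Measure.map_map (measurable_dotProduct_right a) (by fun_prop),
      Measure.map_map measurable_snd (measurable_fst.prodMk (hfm m))]
    congr 1
    ext x
    simp only [Function.comp_apply, dotProduct, hf, Finset.mul_sum, ← Finset.sum_add_distrib]
    refine Finset.sum_congr rfl fun i _ => ?_
    ring
  have hslice : ∀ m z, (Measure.pi fun _ : Fin d => gaussianReal 0 1).map (fun x => f m (z, x)) =
      gaussianReal (a ⬝ᵥ m + u * z * ∑ i, a i) (∑ i, (τ * a i) ^ 2).toNNReal :=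
    fun m z => map_pi_gaussianReal_affine (a ⬝ᵥ m + u * z * ∑ i, a i) fun i => τ * a i
  have hv : (((∑ i, (τ * a i) ^ 2).toNNReal : NNReal) : ℝ) = τ ^ 2 * ∑ i, a i ^ 2 := by
    rw [Real.coe_toNNReal _ (Finset.sum_nonneg fun i _ => sq_nonneg _), Finset.mul_sum]
    simp [mul_pow]
  have hkl : ∀ z, klDiv ((Measure.pi fun _ : Fin d => gaussianReal 0 1).map fun x => f m (z, x))
      ((Measure.pi fun _ : Fin d => gaussianReal 0 1).map fun x => f m' (z, x)) ≤
      ENNReal.ofReal ((a ⬝ᵥ (m - m')) ^ 2 / (2 * τ ^ 2 * ∑ i, a i ^ 2)) := by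
    intro z
    rw [hslice, hslice]
    refine (klDiv_gaussianReal_le _ _ _ ?_).trans (le_of_eq ?_)
    -- Zero variance forces `a = 0`, for which both rewards have the same law.
    · intro h0
      have h1 : τ ^ 2 * ∑ i, a i ^ 2 = 0 := by rw [← hv, h0]; rfl
      have h2 : ∑ i, a i ^ 2 = 0 := by
        rcases mul_eq_zero.1 h1 with h | h
        · exact absurd h (by positivity)
        · exact h
      have h3 : a = 0 := by
        ext i
        have := (Finset.sum_eq_zero_iff_of_nonneg (fun i _ => sq_nonneg (a i))).1 h2 i
          (Finset.mem_univ i)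
        simpa using this
      simp [h3]
    · rw [hv, dotProduct_sub]
      congr 2 <;> ring
  rw [hmap m, hmap m']
  have : IsProbabilityMeasure ((signLaw.prod (Measure.pi fun _ : Fin d => gaussianReal 0 1)).map
        (fun x => (x.1, f m x))) :=
    Measure.isProbabilityMeasure_map (measurable_fst.prodMk (hfm m)).aemeasurable
  have : IsProbabilityMeasure ((signLaw.prod (Measure.pi fun _ : Fin d => gaussianReal 0 1)).map
        (fun x => (x.1, f m' x))) :=
    Measure.isProbabilityMeasure_map (measurable_fst.prodMk (hfm m')).aemeasurable
  refine (klDiv_map_le _ _ measurable_snd).trans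
    ((klDiv_map_prod_graph_le _ _ _ (hfm m) (hfm m') fun z => ?_).trans ?_)
  · refine (klDiv_ne_top_iff.1 (ne_top_of_le_ne_top ?_ (hkl z))).1
    exact ENNReal.ofReal_ne_top
  · calc _ ≤ ∫⁻ _, ENNReal.ofReal ((a ⬝ᵥ (m - m')) ^ 2 / (2 * τ ^ 2 * ∑ i, a i ^ 2)) ∂signLaw :=
          lintegral_mono hkl
      _ = _ := by simp

/-- The divergence of the histories under two Gaussian noise models. -/
lemma klDiv_historyLaw_noisyLaw_le {A : Set (Fin d → ℝ)} (alg : BanditAlgorithm A) (u τ : ℝ)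
    (hτ : 0 < τ) (m m' : Fin d → ℝ) (T : ℕ) :
    klDiv (historyLaw alg (noisyLaw (gaussianReal 0 1) u τ m) T)
        (historyLaw alg (noisyLaw (gaussianReal 0 1) u τ m') T) ≤
      ∑ t ∈ Finset.range T, ∫⁻ h, ∫⁻ a, ENNReal.ofReal (((a : Fin d → ℝ) ⬝ᵥ (m - m')) ^ 2 /
          (2 * τ ^ 2 * ∑ i, (a : Fin d → ℝ) i ^ 2))
        ∂(alg.policy t h) ∂(historyLaw alg (noisyLaw (gaussianReal 0 1) u τ m) t) := by
  refine (klDiv_historyLaw_le alg _ _ (fun a _ => ?_) T).trans ?_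
  · have : IsProbabilityMeasure ((noisyLaw (gaussianReal 0 1) u τ m).map fun θ => a ⬝ᵥ θ) :=
      Measure.isProbabilityMeasure_map (measurable_dotProduct_right a).aemeasurable
    exact (klDiv_ne_top_iff.1 (ne_top_of_le_ne_top ENNReal.ofReal_ne_top
      (klDiv_reward_noisyLaw_le u τ hτ m m' a))).1
  · gcongr with t _ h a
    exact klDiv_reward_noisyLaw_le u τ hτ m m' a

/-- The total information about all the coordinates of the mean is bounded independently of the
algorithm: here `m' i` differs from `m` by `±Δ`, in coordinate `i` only. -/
lemma sum_klDiv_historyLaw_single_le {A : Set (Fin d → ℝ)} (alg : BanditAlgorithm A) (u τ : ℝ)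
    (hτ : 0 < τ) (Δ : ℝ) (m : Fin d → ℝ) (m' : Fin d → Fin d → ℝ) (δ : Fin d → ℝ)
    (hδ : ∀ i, δ i ^ 2 = Δ ^ 2) (hm : ∀ i, m - m' i = Pi.single i (δ i)) (T : ℕ) :
    ∑ i, klDiv (historyLaw alg (noisyLaw (gaussianReal 0 1) u τ m) T)
        (historyLaw alg (noisyLaw (gaussianReal 0 1) u τ (m' i)) T) ≤
      ENNReal.ofReal (T * (Δ ^ 2 / (2 * τ ^ 2))) := by
  have hmeas : ∀ i, Measurable fun a : A => ENNReal.ofReal (((a : Fin d → ℝ) i * δ i) ^ 2 /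
      (2 * τ ^ 2 * ∑ j, (a : Fin d → ℝ) j ^ 2)) := by
    intro i
    have h1 : ∀ j, Measurable fun a : A => (a : Fin d → ℝ) j :=
      fun j => (measurable_pi_apply j).comp measurable_subtype_coe
    exact (((h1 i).mul_const _).pow_const 2 |>.div
      ((Finset.measurable_sum _ fun j _ => (h1 j).pow_const 2).const_mul _)).ennreal_ofReal
  calc _ ≤ ∑ i, ∑ t ∈ Finset.range T, ∫⁻ h, ∫⁻ a, ENNReal.ofReal (((a : Fin d → ℝ) i * δ i) ^ 2 /
          (2 * τ ^ 2 * ∑ j, (a : Fin d → ℝ) j ^ 2))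
        ∂(alg.policy t h) ∂(historyLaw alg (noisyLaw (gaussianReal 0 1) u τ m) t) := by
        refine Finset.sum_le_sum fun i _ => ?_
        refine (klDiv_historyLaw_noisyLaw_le alg u τ hτ m (m' i) T).trans (le_of_eq ?_)
        simp only [hm, dotProduct_single]
    _ = ∑ t ∈ Finset.range T, ∫⁻ h, ∫⁻ a, ∑ i, ENNReal.ofReal (((a : Fin d → ℝ) i * δ i) ^ 2 /
          (2 * τ ^ 2 * ∑ j, (a : Fin d → ℝ) j ^ 2))
        ∂(alg.policy t h) ∂(historyLaw alg (noisyLaw (gaussianReal 0 1) u τ m) t) := by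
        rw [Finset.sum_comm]
        refine Finset.sum_congr rfl fun t _ => ?_
        rw [← lintegral_finsetSum _ fun i _ => (hmeas i).lintegral_kernel]
        refine lintegral_congr fun h => ?_
        rw [lintegral_finsetSum _ fun i _ => hmeas i]
    -- The squared entries of the action add up to `‖a‖₂²`, which cancels the variance: the bound no
    -- longer depends on the action.
    _ ≤ ∑ t ∈ Finset.range T, ENNReal.ofReal (Δ ^ 2 / (2 * τ ^ 2)) := by
        refine Finset.sum_le_sum fun t _ => ?_
        have := alg.isMarkov t
        calc _ ≤ ∫⁻ _, ∫⁻ _, ENNReal.ofReal (Δ ^ 2 / (2 * τ ^ 2)) ∂(alg.policy t _)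
              ∂(historyLaw alg (noisyLaw (gaussianReal 0 1) u τ m) t) := by
              refine lintegral_mono fun h => lintegral_mono fun a => ?_
              rw [← ENNReal.ofReal_sum_of_nonneg fun i _ => div_nonneg (sq_nonneg _)
                (mul_nonneg (by positivity) (Finset.sum_nonneg fun i _ => sq_nonneg _))]
              refine ENNReal.ofReal_le_ofReal ?_
              simp only [mul_pow, hδ]
              rw [← Finset.sum_div, ← Finset.sum_mul]
              -- The zero action reveals nothing, in agreement with division by zero giving zero.
              rcases eq_or_ne (∑ j, (a : Fin d → ℝ) j ^ 2) 0 with h0 | h0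
              · rw [h0]; simp; positivity
              · rw [mul_comm, mul_div_mul_right _ _ h0]
          _ = _ := by simp
    _ = _ := by
        rw [Finset.sum_const, Finset.card_range, nsmul_eq_mul,
          ENNReal.ofReal_mul (Nat.cast_nonneg _), ENNReal.ofReal_natCast]

end NoiseModel

/-! ### Range, mean and variance of the noise -/

section NoisyLawMoments

variable {d : ℕ}

lemma ae_signLaw_sq : ∀ᵐ z ∂signLaw, z ^ 2 = 1 := by
  rw [signLaw, ae_add_measure_iff]
  constructor <;> refine Measure.ae_smul_measure ?_ _ <;> rw [ae_dirac_eq] <;> simp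

lemma integral_signLaw : ∫ z, z ∂signLaw = 0 := by
  rw [signLaw, integral_add_measure (.smul_measure (integrable_dirac (by simp)) (by simp))
    (.smul_measure (integrable_dirac (by simp)) (by simp)), integral_smul_measure,
    integral_smul_measure]
  simp

variable {γ : Measure ℝ} [IsProbabilityMeasure γ] {L : ℝ}

lemma ae_noise_bound (hγ : ∀ᵐ x ∂γ, |x| ≤ L) :
    ∀ᵐ x ∂(signLaw.prod (Measure.pi fun _ : Fin d => γ)), |x.1| = 1 ∧ ∀ i, |x.2 i| ≤ L := by
  have h1 : ∀ᵐ z ∂signLaw, |z| = 1 := by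
    filter_upwards [ae_signLaw_sq] with z hz
    rw [← Real.sqrt_sq_eq_abs, hz, Real.sqrt_one]
  have h2 : ∀ᵐ x ∂(Measure.pi fun _ : Fin d => γ), ∀ i, |x i| ≤ L :=
    ae_all_iff.2 fun i => (Measure.quasiMeasurePreserving_eval (fun _ : Fin d => γ) i).ae hγ
  filter_upwards [Measure.quasiMeasurePreserving_fst.ae h1,
    Measure.quasiMeasurePreserving_snd.ae h2] with x h1 h2 using ⟨h1, h2⟩

lemma ae_noisyLaw_bound (hγ : ∀ᵐ x ∂γ, |x| ≤ L) (u τ : ℝ) (m : Fin d → ℝ) :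
    ∀ᵐ θ ∂(noisyLaw γ u τ m), ∀ i, |θ i| ≤ |m i| + |u| + |τ| * L := by
  rw [noisyLaw, ae_map_iff (measurable_noisyLaw_map u τ m).aemeasurable]
  · filter_upwards [ae_noise_bound (d := d) hγ] with x ⟨h1, h2⟩ i
    calc |m i + u * x.1 + τ * x.2 i| ≤ |m i| + |u * x.1| + |τ * x.2 i| := abs_add_three _ _ _
      _ ≤ _ := by
        rw [abs_mul, abs_mul, h1, mul_one]
        gcongr
        exact h2 i
  · simp only [Set.ofPred_forall]
    exact MeasurableSet.iInter fun i =>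
      measurableSet_le ((measurable_pi_apply i).abs) measurable_const

lemma memLp_noisyLaw (hγ : ∀ᵐ x ∂γ, |x| ≤ L) (u τ : ℝ) (m : Fin d → ℝ) (i : Fin d) :
    MemLp (fun θ : Fin d → ℝ => θ i) 2 (noisyLaw γ u τ m) :=
  MemLp.of_bound (measurable_pi_apply i).aestronglyMeasurable (|m i| + |u| + |τ| * L) (by
    filter_upwards [ae_noisyLaw_bound hγ u τ m] with θ hθ using hθ i)

lemma integral_noise_fst : ∫ x, x.1 ∂(signLaw.prod (Measure.pi fun _ : Fin d => γ)) = 0 := by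
  rw [← integral_signLaw]
  simpa using integral_prod_mul (μ := signLaw) (ν := Measure.pi fun _ : Fin d => γ)
    (fun z : ℝ => z) (fun _ => (1 : ℝ))

lemma integral_noise_snd (g : ℝ → ℝ) (hg : Measurable g) (i : Fin d) :
    ∫ x, g (x.2 i) ∂(signLaw.prod (Measure.pi fun _ : Fin d => γ)) = ∫ x, g x ∂γ := by
  have h1 := integral_prod_mul (μ := signLaw) (ν := Measure.pi fun _ : Fin d => γ)
    (fun _ : ℝ => (1 : ℝ)) (fun x => g (x i))
  simp only [one_mul, integral_const, probReal_univ, smul_eq_mul] at h1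
  rw [h1]
  have h2 := (measurePreserving_eval (fun _ : Fin d => γ) i).map_eq
  conv_rhs => rw [← h2]
  rw [integral_map (measurable_pi_apply i).aemeasurable hg.aestronglyMeasurable]

lemma integral_noise_mul (i : Fin d) :
    ∫ x, x.1 * x.2 i ∂(signLaw.prod (Measure.pi fun _ : Fin d => γ)) = 0 := by
  have h1 := integral_prod_mul (μ := signLaw) (ν := Measure.pi fun _ : Fin d => γ)
    (fun z : ℝ => z) (fun x => x i)
  rw [h1, integral_signLaw, zero_mul]

lemma meanVector_noisyLaw (hγ : ∀ᵐ x ∂γ, |x| ≤ L) (h0 : ∫ x, x ∂γ = 0) (u τ : ℝ)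
    (m : Fin d → ℝ) : meanVector (noisyLaw γ u τ m) = m := by
  ext i
  have hmap := integral_map (μ := signLaw.prod (Measure.pi fun _ : Fin d => γ))
    (measurable_noisyLaw_map u τ m).aemeasurable
    (f := fun θ => θ i) (measurable_pi_apply i).aestronglyMeasurable
  rw [meanVector, noisyLaw, hmap]
  have hb := ae_noise_bound (d := d) hγ
  have i1 : Integrable (fun x : ℝ × (Fin d → ℝ) => x.1)
      (signLaw.prod (Measure.pi fun _ : Fin d => γ)) :=
    .of_bound (by fun_prop) 1 (by filter_upwards [hb] with x hx using hx.1.le)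
  have i2 : Integrable (fun x : ℝ × (Fin d → ℝ) => x.2 i)
      (signLaw.prod (Measure.pi fun _ : Fin d => γ)) :=
    .of_bound (by fun_prop) L (by filter_upwards [hb] with x hx using hx.2 i)
  have i3 : Integrable (fun x : ℝ × (Fin d → ℝ) => m i + u * x.1)
      (signLaw.prod (Measure.pi fun _ : Fin d => γ)) := (integrable_const _).add (i1.const_mul _)
  rw [integral_add i3 (i2.const_mul _),
    integral_add (integrable_const _) (i1.const_mul _), integral_const_mul, integral_const_mul,
    integral_noise_fst, integral_noise_snd (fun x => x) measurable_id, h0]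
  simp

lemma covMatrix_noisyLaw_diag (hγ : ∀ᵐ x ∂γ, |x| ≤ L) (h0 : ∫ x, x ∂γ = 0) (u τ : ℝ)
    (m : Fin d → ℝ) (i : Fin d) :
    covMatrix (noisyLaw γ u τ m) i i = u ^ 2 + τ ^ 2 * ∫ x, x ^ 2 ∂γ := by
  have hmean : ∫ θ, θ i ∂(noisyLaw γ u τ m) = m i :=
    congrFun (meanVector_noisyLaw hγ h0 u τ m) i
  simp only [covMatrix, Matrix.of_apply, covariance, hmean]
  rw [noisyLaw, integral_map (by fun_prop) (by fun_prop)]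
  have hb := ae_noise_bound (d := d) hγ
  have i1 : Integrable (fun x : ℝ × (Fin d → ℝ) => x.1 * x.2 i)
      (signLaw.prod (Measure.pi fun _ : Fin d => γ)) :=
    .of_bound (by fun_prop) L (by
      filter_upwards [hb] with x hx
      rw [Real.norm_eq_abs, abs_mul, hx.1, one_mul]
      exact hx.2 i)
  have i2 : Integrable (fun x : ℝ × (Fin d → ℝ) => x.2 i ^ 2)
      (signLaw.prod (Measure.pi fun _ : Fin d => γ)) :=
    .of_bound (by fun_prop) (L ^ 2) (by
      filter_upwards [hb] with x hx
      rw [Real.norm_eq_abs, abs_pow]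
      exact pow_le_pow_left₀ (abs_nonneg _) (hx.2 i) 2)
  have hae : ∀ᵐ x ∂(signLaw.prod (Measure.pi fun _ : Fin d => γ)),
      (m i + u * x.1 + τ * x.2 i - m i) * (m i + u * x.1 + τ * x.2 i - m i) =
        u ^ 2 + 2 * u * τ * (x.1 * x.2 i) + τ ^ 2 * x.2 i ^ 2 := by
    filter_upwards [hb] with x hx
    have : x.1 ^ 2 = 1 := by rw [← sq_abs, hx.1, one_pow]
    linear_combination u ^ 2 * this
  have i3 : Integrable (fun x : ℝ × (Fin d → ℝ) => u ^ 2 + 2 * u * τ * (x.1 * x.2 i))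
      (signLaw.prod (Measure.pi fun _ : Fin d => γ)) := (integrable_const _).add (i1.const_mul _)
  rw [integral_congr_ae hae, integral_add i3 (i2.const_mul _),
    integral_add (integrable_const _) (i1.const_mul _), integral_const_mul, integral_const_mul,
    integral_noise_mul, integral_noise_snd (fun x => x ^ 2) (by fun_prop)]
  simp

lemma noisyLaw_le_smul {γ γ' : Measure ℝ} [IsProbabilityMeasure γ] [IsProbabilityMeasure γ']
    {c : ENNReal}
    (h : (Measure.pi fun _ : Fin d => γ) ≤ c • (Measure.pi fun _ : Fin d => γ')) (u τ : ℝ)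
    (m : Fin d → ℝ) : noisyLaw γ u τ m ≤ c • noisyLaw γ' u τ m := by
  refine Measure.le_iff.2 fun s hs => ?_
  have hs' := measurable_noisyLaw_map u τ m hs
  rw [noisyLaw, noisyLaw, Measure.smul_apply, Measure.map_apply (measurable_noisyLaw_map u τ m) hs,
    Measure.map_apply (measurable_noisyLaw_map u τ m) hs, Measure.prod_apply hs',
    Measure.prod_apply hs', smul_eq_mul, ← lintegral_const_mul _ (measurable_measure_prodMk_left hs')]
  exact lintegral_mono fun a => h _

end NoisyLawMoments

/-! ### Truncated Gaussians and the cost of truncation -/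

section TruncatedGaussian

/-- The standard Gaussian distribution conditioned on `[-L, L]`. -/
noncomputable def truncGaussian (L : ℝ) : Measure ℝ := (gaussianReal 0 1)[|Set.Icc (-L) L]

/-- Chernoff's bound with parameter `L` for the upper tail, symmetry for the lower one. -/
lemma gaussianReal_real_Icc_ge {L : ℝ} (hL : 0 ≤ L) :
    1 - 2 * Real.exp (-L ^ 2 / 2) ≤ (gaussianReal 0 1).real (Set.Icc (-L) L) := by
  have htail : (gaussianReal 0 1).real {x | L ≤ x} ≤ Real.exp (-L ^ 2 / 2) := by
    have := measure_ge_le_exp_mul_mgf (μ := gaussianReal 0 1) (X := fun x : ℝ => x) L hL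
      (integrable_exp_mul_gaussianReal L)
    rw [mgf_fun_id_gaussianReal, ← Real.exp_add] at this
    convert this using 2
    push_cast
    ring
  have htail' : (gaussianReal 0 1).real {x | x ≤ -L} ≤ Real.exp (-L ^ 2 / 2) := by
    have h1 : (gaussianReal 0 1).map (fun x => -x) = gaussianReal 0 1 := by
      simpa using gaussianReal_map_neg (μ := 0) (v := 1)
    have h2 : (gaussianReal 0 1).map (fun x => -x) {x | x ≤ -L} =
        gaussianReal 0 1 ((fun x => -x) ⁻¹' {x | x ≤ -L}) :=
      Measure.map_apply measurable_neg measurableSet_Iic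
    rw [← h1, measureReal_def, h2, ← measureReal_def]
    simpa using htail
  have hsub : (Set.Icc (-L) L)ᶜ ⊆ {x | L ≤ x} ∪ {x | x ≤ -L} := by
    intro x hx
    simp only [Set.mem_compl_iff, Set.mem_Icc, not_and_or, not_le] at hx
    rcases hx with h | h
    · exact Or.inr h.le
    · exact Or.inl h.le
  have h2 := (measureReal_mono hsub (μ := gaussianReal 0 1)).trans (measureReal_union_le _ _)
  rw [probReal_compl_eq_one_sub measurableSet_Icc] at h2
  linarith

variable {L : ℝ}

lemma gaussianReal_Icc_ne_zero (hL : 2 ≤ L) : gaussianReal 0 1 (Set.Icc (-L) L) ≠ 0 := by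
  intro h
  have h1 := gaussianReal_real_Icc_ge (L := L) (by linarith)
  rw [measureReal_def, h, ENNReal.toReal_zero] at h1
  have h2 : -L ^ 2 / 2 ≤ -2 := by nlinarith
  have h3 := Real.exp_le_exp.2 h2
  have h4 : 4 < Real.exp 2 := by
    have := Real.exp_one_gt_d9
    rw [show (2 : ℝ) = 1 + 1 by norm_num, Real.exp_add]
    nlinarith
  have h5 : Real.exp (-2) < 1 / 4 := by
    rw [Real.exp_neg, ← one_div]
    exact one_div_lt_one_div_of_lt (by norm_num) h4
  linarith

lemma isProbabilityMeasure_truncGaussian (hL : 2 ≤ L) : IsProbabilityMeasure (truncGaussian L) :=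
  cond_isProbabilityMeasure (gaussianReal_Icc_ne_zero hL)

lemma ae_truncGaussian_abs_le : ∀ᵐ x ∂truncGaussian L, |x| ≤ L := by
  filter_upwards [ae_cond_mem measurableSet_Icc] with x hx using abs_le.2 hx

lemma integral_truncGaussian : ∫ x, x ∂truncGaussian L = 0 := by
  have h1 : (gaussianReal 0 1).map (fun x => -x) = gaussianReal 0 1 := by
    simpa using gaussianReal_map_neg (μ := 0) (v := 1)
  have h2 : ∫ x in Set.Icc (-L) L, x ∂(gaussianReal 0 1) =
      ∫ x in Set.Icc (-L) L, -x ∂(gaussianReal 0 1) := by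
    have hp : MeasurePreserving (fun x : ℝ => -x) (gaussianReal 0 1) (gaussianReal 0 1) :=
      ⟨measurable_neg, h1⟩
    have := hp.setIntegral_preimage_emb (MeasurableEquiv.neg ℝ).measurableEmbedding
      (fun x => x) (Set.Icc (-L) L)
    rw [← this]
    simp
  rw [integral_neg] at h2
  rw [truncGaussian, ProbabilityTheory.cond, integral_smul_measure]
  have : ∫ x in Set.Icc (-L) L, x ∂(gaussianReal 0 1) = 0 := by linarith
  rw [this, smul_zero]

/-- A crude bound suffices: it only ensures that the Gaussian part does not exceed the prescribed
variance, the sign supplying the rest. -/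
lemma integral_sq_truncGaussian_le (hL : 2 ≤ L) : ∫ x, x ^ 2 ∂truncGaussian L ≤ L ^ 2 := by
  have := isProbabilityMeasure_truncGaussian hL
  have h1 : ∀ᵐ x ∂truncGaussian L, x ^ 2 ≤ L ^ 2 := by
    filter_upwards [ae_truncGaussian_abs_le] with x hx
    rw [← sq_abs]
    exact pow_le_pow_left₀ (abs_nonneg _) hx 2
  have h2 : Integrable (fun x : ℝ => x ^ 2) (truncGaussian L) :=
    .of_bound (by fun_prop) (L ^ 2) (by
      filter_upwards [h1] with x hx
      rwa [Real.norm_of_nonneg (sq_nonneg x)])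
  simpa using integral_mono_ae h2 (integrable_const _) h1

/-- Conditioning multiplies the density by at most the inverse mass of the interval, once for each
coordinate. -/
lemma pi_truncGaussian_le (hL : 2 ≤ L) (d : ℕ) :
    (Measure.pi fun _ : Fin d => truncGaussian L) ≤
      ((gaussianReal 0 1 (Set.Icc (-L) L))⁻¹ ^ d) • (Measure.pi fun _ : Fin d => gaussianReal 0 1) := by
  have := isProbabilityMeasure_truncGaussian hL
  have h : (Measure.pi fun _ : Fin d => truncGaussian L) =
      ((gaussianReal 0 1 (Set.Icc (-L) L))⁻¹ ^ d) •
        (Measure.pi fun _ : Fin d => (gaussianReal 0 1).restrict (Set.Icc (-L) L)) := by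
    refine Measure.pi_eq fun s hs => ?_
    rw [Measure.smul_apply, Measure.pi_pi, smul_eq_mul]
    simp only [truncGaussian, ProbabilityTheory.cond, Measure.smul_apply, smul_eq_mul, Finset.prod_mul_distrib,
      Finset.prod_const, Finset.card_univ, Fintype.card_fin]
  rw [h, ← Measure.restrict_pi_pi]
  refine Measure.le_iff.2 fun s hs => ?_
  simp only [Measure.smul_apply, smul_eq_mul]
  gcongr
  exact Measure.restrict_le_self

/-- Truncating the noise at a logarithmic level hardly increases the probability of any event. -/
lemma historyLaw_truncGaussian_real_le {d T : ℕ} {A : Set (Fin d → ℝ)} (alg : BanditAlgorithm A)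
    (hd : 1 ≤ d) (hdT : d ≤ T) (hL : L = √(8 * (1 + Real.log T))) (u τ : ℝ) (m : Fin d → ℝ)
    (s : Set (Fin T → A × ℝ)) :
    (historyLaw alg (noisyLaw (truncGaussian L) u τ m) T).real s ≤
      10 / 9 * (historyLaw alg (noisyLaw (gaussianReal 0 1) u τ m) T).real s := by
  have hT : (1 : ℝ) ≤ T := by exact_mod_cast hd.trans hdT
  have hlog : 0 ≤ Real.log T := Real.log_nonneg hT
  have hL2 : L ^ 2 = 8 * (1 + Real.log T) := by rw [hL, Real.sq_sqrt (by positivity)]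
  have hL' : 2 ≤ L := by
    rw [hL]; exact Real.le_sqrt_of_sq_le (by nlinarith)
  have := isProbabilityMeasure_truncGaussian hL'
  set g := gaussianReal 0 1 (Set.Icc (-L) L) with hg
  have hg0 : g ≠ 0 := gaussianReal_Icc_ne_zero hL'
  have hgt : g ≠ ⊤ := measure_ne_top _ _
  have hdom := historyLaw_le_smul alg _ _ (noisyLaw_le_smul (pi_truncGaussian_le hL' d) u τ m) T s
  rw [Measure.smul_apply, smul_eq_mul, ← hg, ← pow_mul] at hdom
  have hC : ((g⁻¹ ^ (d * T)).toReal) ≤ 10 / 9 := by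
    rw [ENNReal.toReal_pow, ENNReal.toReal_inv, inv_pow]
    have h1 : 1 - 2 * Real.exp (-L ^ 2 / 2) ≤ g.toReal := gaussianReal_real_Icc_ge (by linarith)
    -- The level `L` is chosen for this: each of the `d * T` Gaussian draws leaves the interval with
    -- probability at most `1 / (10 T²)`.
    have hexp : Real.exp (-L ^ 2 / 2) ≤ 1 / 20 * (1 / (T : ℝ) ^ 2) := by
      have e1 : -L ^ 2 / 2 ≤ -4 + -(2 * Real.log T) := by linarith
      refine (Real.exp_le_exp.2 e1).trans ?_
      rw [Real.exp_add]
      have e2 : Real.exp (-(2 * Real.log T)) = 1 / (T : ℝ) ^ 2 := by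
        rw [Real.exp_neg, ← one_div, mul_comm, ← Nat.cast_ofNat (n := 2), ← Real.rpow_natCast,
          ← Real.rpow_def_of_pos (by linarith)]
      have e3 : Real.exp (-4) ≤ 1 / 20 := by
        rw [Real.exp_neg, ← one_div]
        refine one_div_le_one_div_of_le (by norm_num) ?_
        have := Real.exp_one_gt_d9
        have h4 : Real.exp 4 = Real.exp 1 ^ 4 := by rw [← Real.exp_nat_mul]; norm_num
        rw [h4]
        calc (20 : ℝ) ≤ 2.7 ^ 4 := by norm_num
          _ ≤ _ := pow_le_pow_left₀ (by norm_num) (by linarith) 4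
      rw [e2]
      gcongr
    have hdT' : ((d * T : ℕ) : ℝ) ≤ (T : ℝ) ^ 2 := by
      rw [sq]; exact_mod_cast Nat.mul_le_mul_right T hdT
    have hT2 : (0 : ℝ) < (T : ℝ) ^ 2 := by positivity
    have hsmall : 2 * Real.exp (-L ^ 2 / 2) ≤ 1 / 10 * (1 / (T : ℝ) ^ 2) := by linarith
    have hle1 : 1 / (T : ℝ) ^ 2 ≤ 1 := by
      rw [div_le_one hT2]; exact one_le_pow₀ hT
    -- Bernoulli's inequality; `d ≤ T` gives `d * T ≤ T²`, so the total loss is at most `1/10`.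
    have hpow : (9 / 10 : ℝ) ≤ g.toReal ^ (d * T) := by
      calc (9 / 10 : ℝ) ≤ 1 + ((d * T : ℕ) : ℝ) * (-(2 * Real.exp (-L ^ 2 / 2))) := by
            have : ((d * T : ℕ) : ℝ) * (2 * Real.exp (-L ^ 2 / 2)) ≤
                (T : ℝ) ^ 2 * (1 / 10 * (1 / (T : ℝ) ^ 2)) := by gcongr
            have h3 : (T : ℝ) ^ 2 * (1 / 10 * (1 / (T : ℝ) ^ 2)) = 1 / 10 := by field_simp
            linarith
        _ ≤ (1 + -(2 * Real.exp (-L ^ 2 / 2))) ^ (d * T) :=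
            one_add_mul_le_pow (by linarith) _
        _ ≤ _ := pow_le_pow_left₀ (by linarith) (by linarith) _
    rw [show (10 / 9 : ℝ) = (9 / 10)⁻¹ by norm_num]
    exact inv_anti₀ (by norm_num) hpow
  rw [measureReal_def, measureReal_def]
  calc _ ≤ (g⁻¹ ^ (d * T) * historyLaw alg (noisyLaw (gaussianReal 0 1) u τ m) T s).toReal :=
        ENNReal.toReal_mono (ENNReal.mul_ne_top (ENNReal.pow_ne_top (ENNReal.inv_ne_top.2 hg0))
          (measure_ne_top _ _)) hdom
    _ ≤ _ := by
        rw [ENNReal.toReal_mul]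
        gcongr

end TruncatedGaussian

/-! ### Hölder's inequality and concavity on the ball -/

section LpBall

variable {d : ℕ} {p q : ℝ}

lemma sum_rpow_le_one_of_mem_lpUnitBall (hp : 1 < p) {a : Fin d → ℝ} (ha : a ∈ lpUnitBall d p) :
    ∑ i, |a i| ^ p ≤ 1 := by
  have hp0 : 0 < p := by linarith
  have htr : (ENNReal.ofReal p).toReal = p := ENNReal.toReal_ofReal hp0.le
  rw [lpUnitBall, Set.mem_ofPred_eq, PiLp.norm_eq_sum (by rw [htr]; exact hp0), htr] at ha
  have h0 : 0 ≤ ∑ i, |a i| ^ p := Finset.sum_nonneg fun i _ => by positivity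
  by_contra hlt
  push Not at hlt
  have := Real.one_lt_rpow hlt (one_div_pos.2 hp0)
  simp only [Real.norm_eq_abs] at ha
  linarith

lemma mem_lpUnitBall_of_sum_rpow_le_one (hp : 1 < p) {a : Fin d → ℝ} (ha : ∑ i, |a i| ^ p ≤ 1) :
    a ∈ lpUnitBall d p := by
  have hp0 : 0 < p := by linarith
  have htr : (ENNReal.ofReal p).toReal = p := ENNReal.toReal_ofReal hp0.le
  rw [lpUnitBall, Set.mem_ofPred_eq, PiLp.norm_eq_sum (by rw [htr]; exact hp0), htr]
  simp only [Real.norm_eq_abs]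
  exact Real.rpow_le_one (Finset.sum_nonneg fun i _ => by positivity) ha (one_div_pos.2 hp0).le

lemma abs_le_one_of_mem_lpUnitBall (hp : 1 < p) {a : Fin d → ℝ} (ha : a ∈ lpUnitBall d p)
    (i : Fin d) : |a i| ≤ 1 := by
  by_contra h
  push Not at h
  have h1 := Real.one_lt_rpow h (by linarith : 0 < p)
  have h2 := Finset.single_le_sum (f := fun i => |a i| ^ p) (fun i _ => by positivity)
    (Finset.mem_univ i)
  have h3 := sum_rpow_le_one_of_mem_lpUnitBall hp ha
  linarith

lemma sum_abs_le_card_rpow (hp : 1 < p) (hpq : p.HolderConjugate q) {a : Fin d → ℝ}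
    (ha : a ∈ lpUnitBall d p) (S : Finset (Fin d)) :
    ∑ i ∈ S, |a i| ≤ (S.card : ℝ) ^ (1 / q) := by
  have h1 := Real.inner_le_Lp_mul_Lq S (fun i => |a i|) (fun _ => 1) hpq
  simp only [mul_one, abs_abs, abs_one, Real.one_rpow, Finset.sum_const, nsmul_eq_mul] at h1
  refine h1.trans ?_
  have h2 : ∑ i ∈ S, |a i| ^ p ≤ 1 :=
    (Finset.sum_le_sum_of_subset_of_nonneg (Finset.subset_univ S)
      fun i _ _ => by positivity).trans (sum_rpow_le_one_of_mem_lpUnitBall hp ha)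
  have h3 : (∑ i ∈ S, |a i| ^ p) ^ (1 / p) ≤ 1 :=
    Real.rpow_le_one (Finset.sum_nonneg fun i _ => by positivity) h2
      (one_div_pos.2 (by linarith)).le
  exact mul_le_of_le_one_left (by positivity) h3

lemma abs_dotProduct_le_one (hp : 1 < p) (hpq : p.HolderConjugate q) (hd : 1 ≤ d)
    {a θ : Fin d → ℝ} (ha : a ∈ lpUnitBall d p) (hθ : ∀ i, |θ i| ≤ (d : ℝ) ^ (-(1 / q))) :
    |a ⬝ᵥ θ| ≤ 1 := by
  have hd' : (0 : ℝ) < d := by exact_mod_cast hd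
  calc |a ⬝ᵥ θ| ≤ ∑ i, |a i * θ i| := Finset.abs_sum_le_sum_abs _ _
    _ ≤ ∑ i, |a i| * (d : ℝ) ^ (-(1 / q)) := by
      refine Finset.sum_le_sum fun i _ => ?_
      rw [abs_mul]
      exact mul_le_mul_of_nonneg_left (hθ i) (abs_nonneg _)
    _ ≤ (d : ℝ) ^ (1 / q) * (d : ℝ) ^ (-(1 / q)) := by
      rw [← Finset.sum_mul]
      have := sum_abs_le_card_rpow hp hpq ha Finset.univ
      rw [Finset.card_univ, Fintype.card_fin] at this
      gcongr
    _ = 1 := by rw [← Real.rpow_add hd']; simp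

/-- The tangent-line bound `n ^ (1 / q) ≤ d ^ (1 / q) * (1 - (1 - n / d) / q)`. -/
lemma rpow_one_div_le_tangent (hq : 1 ≤ q) {n : ℝ} (hn : 0 ≤ n) {D : ℝ} (hD : 0 < D) :
    n ^ (1 / q) ≤ D ^ (1 / q) * (1 - (1 - n / D) / q) := by
  -- Bernoulli's inequality for an exponent at most 1, that is, concavity at `n = D`.
  have h1 := rpow_one_add_le_one_add_mul_self (s := n / D - 1) (p := 1 / q)
    (by have : 0 ≤ n / D := by positivity
        linarith) (by positivity) (by rw [div_le_one (by linarith)]; exact hq)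
  have h2 : n = D * (1 + (n / D - 1)) := by field_simp; ring
  conv_lhs => rw [h2]
  rw [Real.mul_rpow hD.le (by rw [add_sub_cancel]; positivity)]
  refine mul_le_mul_of_nonneg_left (h1.trans (le_of_eq ?_)) (by positivity)
  ring

end LpBall

/-! ### From probabilities of good actions to regret -/

section Regret

variable {d : ℕ} {A : Set (Fin d → ℝ)}

/-- A lower bound for the expected regret in terms of the probabilities of events which every
action with small regret must satisfy. -/
lemma le_expectedRegret {ι : Type*} [Fintype ι] (alg : BanditAlgorithm A)
    (ν : Measure (Fin d → ℝ)) [IsProbabilityMeasure ν] (aStar : Fin d → ℝ) (T : ℕ) (B w C : ℝ)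
    (E : ι → Set (Fin d → ℝ)) (hE : ∀ i, MeasurableSet (E i))
    (hA : ∀ a ∈ A, ∀ i, |a i| ≤ 1)
    (hB : ∀ a ∈ A, B * (1 - w * ∑ i, (E i).indicator 1 a) ≤ (aStar - a) ⬝ᵥ meanVector ν)
    (hB0 : 0 ≤ B)
    (hC : w * ∑ t : Fin T, ∑ i,
      (historyLaw alg ν T).real {h | ((h t).1 : Fin d → ℝ) ∈ E i} ≤ C) :
    B * (T - C) ≤ expectedRegret alg ν aStar T := by
  set H := historyLaw alg ν T
  have hact : ∀ t : Fin T, Measurable fun h : Fin T → A × ℝ => ((h t).1 : Fin d → ℝ) :=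
    fun t => measurable_subtype_coe.comp (measurable_fst.comp (measurable_pi_apply t))
  have hmeas : ∀ (t : Fin T) i, MeasurableSet {h : Fin T → A × ℝ | ((h t).1 : Fin d → ℝ) ∈ E i} :=
    fun t i => hact t (hE i)
  have hind : ∀ t i, Integrable (fun h : Fin T → A × ℝ =>
      (E i).indicator (1 : (Fin d → ℝ) → ℝ) ((h t).1 : Fin d → ℝ)) H := by
    intro t i
    refine .of_bound ?_ 1 (.of_forall fun h => ?_)
    · exact ((measurable_one.indicator (hE i)).comp (hact t)).aestronglyMeasurable
    · by_cases hh : ((h t).1 : Fin d → ℝ) ∈ E i <;> simp [hh]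
  have hint : ∀ t i, ∫ h, (E i).indicator (1 : (Fin d → ℝ) → ℝ) ((h t).1 : Fin d → ℝ) ∂H =
      H.real {h | ((h t).1 : Fin d → ℝ) ∈ E i} := by
    intro t i
    rw [← integral_indicator_one (hmeas t i)]
    rfl
  have hsum : ∀ t, Integrable (fun h : Fin T → A × ℝ => B * (1 - w * ∑ i,
      (E i).indicator (1 : (Fin d → ℝ) → ℝ) ((h t).1 : Fin d → ℝ))) H := fun t =>
    ((integrable_const _).sub ((integrable_finsetSum _ fun i _ => hind t i).const_mul w)).const_mul B
  have hreg : ∀ t : Fin T, Integrable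
      (fun h : Fin T → A × ℝ => (aStar - ((h t).1 : Fin d → ℝ)) ⬝ᵥ meanVector ν) H := by
    intro t
    refine .of_bound ?_ (∑ i, (|aStar i| + 1) * |meanVector ν i|) (.of_forall fun h => ?_)
    · refine Measurable.aestronglyMeasurable ?_
      unfold dotProduct
      exact Finset.measurable_sum _ fun i _ =>
        (measurable_const.sub ((measurable_pi_apply i).comp (hact t))).mul_const _
    · refine (Finset.abs_sum_le_sum_abs _ _).trans (Finset.sum_le_sum fun i _ => ?_)
      rw [abs_mul, Pi.sub_apply]
      refine mul_le_mul_of_nonneg_right ((abs_sub _ _).trans ?_) (abs_nonneg _)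
      gcongr
      exact hA _ (h t).1.2 i
  calc B * (T - C) ≤ B * (T - w * ∑ t : Fin T, ∑ i, H.real {h | ((h t).1 : Fin d → ℝ) ∈ E i}) := by
        gcongr
    _ = ∑ t : Fin T, ∫ h, B * (1 - w * ∑ i,
          (E i).indicator (1 : (Fin d → ℝ) → ℝ) ((h t).1 : Fin d → ℝ)) ∂H := by
        have : ∀ t : Fin T, ∫ h, B * (1 - w * ∑ i,
            (E i).indicator (1 : (Fin d → ℝ) → ℝ) ((h t).1 : Fin d → ℝ)) ∂H =
            B * (1 - w * ∑ i, H.real {h | ((h t).1 : Fin d → ℝ) ∈ E i}) := by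
          intro t
          rw [integral_const_mul, integral_sub (integrable_const _)
            ((integrable_finsetSum _ fun i _ => hind t i).const_mul w), integral_const_mul,
            integral_finsetSum _ fun i _ => hind t i]
          simp [hint]
        simp only [this]
        rw [← Finset.mul_sum, Finset.sum_sub_distrib, ← Finset.mul_sum]
        simp
    _ ≤ ∑ t : Fin T, ∫ h, (aStar - ((h t).1 : Fin d → ℝ)) ⬝ᵥ meanVector ν ∂H :=
        Finset.sum_le_sum fun t _ => integral_mono (hsum t) (hreg t) fun h => hB _ (h t).1.2
    _ = expectedRegret alg ν aStar T := by
        rw [expectedRegret, integral_finsetSum _ fun t _ => hreg t]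

end Regret

/-! ### Averaging over the hard instances -/

section Averaging

open InformationTheory

variable {d : ℕ} {A : Set (Fin d → ℝ)}

/-- The sign `±1` encoded by a Boolean. -/
def boolSign (b : Bool) : ℝ := if b then 1 else -1

lemma boolSign_sq (b : Bool) : boolSign b ^ 2 = 1 := by cases b <;> simp [boolSign]

lemma boolSign_not (b : Bool) : boolSign (!b) = -boolSign b := by cases b <;> simp [boolSign]

lemma abs_boolSign (b : Bool) : |boolSign b| = 1 := by cases b <;> simp [boolSign]

lemma measureReal_le_add_klDiv {α : Type*} {mα : MeasurableSpace α} (μ ν : Measure α)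
    [IsFiniteMeasure μ] [IsFiniteMeasure ν] (h : klDiv μ ν ≠ ⊤) (s : Set α) :
    μ.real s ≤ 5 / 4 * ν.real s + 5 * (klDiv μ ν).toReal := by
  have h1 := ENNReal.toReal_mono (ENNReal.add_ne_top.2
    ⟨ENNReal.mul_ne_top ENNReal.ofReal_ne_top (measure_ne_top ν s),
      ENNReal.mul_ne_top (by simp) h⟩) (measure_le_add_klDiv μ ν s)
  rw [ENNReal.toReal_add (ENNReal.mul_ne_top ENNReal.ofReal_ne_top (measure_ne_top ν s))
    (ENNReal.mul_ne_top (by simp) h), ENNReal.toReal_mul, ENNReal.toReal_mul,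
    ENNReal.toReal_ofReal (by norm_num)] at h1
  simpa [measureReal_def] using h1

lemma measureReal_le_add_klDiv' {α : Type*} {mα : MeasurableSpace α} (μ ν : Measure α)
    [IsFiniteMeasure μ] [IsFiniteMeasure ν] (h : klDiv μ ν ≠ ⊤) (s : Set α) :
    ν.real s ≤ 5 / 4 * μ.real s + 5 * (klDiv μ ν).toReal := by
  have h1 := ENNReal.toReal_mono (ENNReal.add_ne_top.2
    ⟨ENNReal.mul_ne_top ENNReal.ofReal_ne_top (measure_ne_top μ s),
      ENNReal.mul_ne_top (by simp) h⟩) (measure_le_add_klDiv' μ ν s)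
  rw [ENNReal.toReal_add (ENNReal.mul_ne_top ENNReal.ofReal_ne_top (measure_ne_top μ s))
    (ENNReal.mul_ne_top (by simp) h), ENNReal.toReal_mul, ENNReal.toReal_mul,
    ENNReal.toReal_ofReal (by norm_num)] at h1
  simpa [measureReal_def] using h1

/-- A sum of divergences bounded by a real number: each term is finite, and the bound holds for
the real-valued divergences. -/
lemma sum_toReal_le_of_sum_le_ofReal {ι : Type*} [Fintype ι] {f : ι → ENNReal} {c : ℝ}
    (hc : 0 ≤ c) (h : ∑ i, f i ≤ ENNReal.ofReal c) :
    (∀ i, f i ≠ ⊤) ∧ ∑ i, (f i).toReal ≤ c := by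
  have h1 : ∀ i, f i ≠ ⊤ := fun i =>
    ne_top_of_le_ne_top ENNReal.ofReal_ne_top
      ((Finset.single_le_sum (fun _ _ => zero_le) (Finset.mem_univ i)).trans h)
  refine ⟨h1, ?_⟩
  rw [← ENNReal.toReal_sum fun i _ => h1 i]
  exact (ENNReal.toReal_mono ENNReal.ofReal_ne_top h).trans (ENNReal.toReal_ofReal hc).le

/-- For some sign vector, the algorithm misses a constant fraction of the signs of the mean. -/
lemma exists_signs_sum_measureReal_le (alg : BanditAlgorithm A) (u τ Δ : ℝ) (hτ : 0 < τ) (T : ℕ)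
    (hΔ : T * Δ ^ 2 ≤ τ ^ 2 * d / 64) :
    ∃ ξ : Fin d → Bool, ∑ t : Fin T, ∑ i,
      (historyLaw alg (noisyLaw (gaussianReal 0 1) u τ fun i => boolSign (ξ i) * Δ) T).real
        {h | 0 < boolSign (ξ i) * ((h t).1 : Fin d → ℝ) i} ≤ 27 / 40 * (d * T) := by
  set H : (Fin d → ℝ) → Measure (Fin T → A × ℝ) :=
    fun m => historyLaw alg (noisyLaw (gaussianReal 0 1) u τ m) T with hH
  set m : (Fin d → Bool) → Fin d → ℝ := fun ξ i => boolSign (ξ i) * Δ with hm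
  set S : Fin T → Fin d → Bool → Set (Fin T → A × ℝ) :=
    fun t i b => {h | 0 < boolSign b * ((h t).1 : Fin d → ℝ) i} with hS
  have hSm : ∀ t i b, MeasurableSet (S t i b) := by
    intro t i b
    refine measurableSet_lt measurable_const (Measurable.const_mul ?_ _)
    exact (measurable_pi_apply i).comp
      (measurable_subtype_coe.comp (measurable_fst.comp (measurable_pi_apply t)))
  set K : (Fin d → Bool) → Fin d → ℝ :=
    -- The true mean is the first argument, because the budget summed over `i` requires one fixed
    -- law in that place.
    fun ξ i => (klDiv (H (m ξ)) (H (Function.update (m ξ) i 0))).toReal with hK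
  have hKL : ∀ ξ, (∀ i, klDiv (H (m ξ)) (H (Function.update (m ξ) i 0)) ≠ ⊤) ∧
      ∑ i, K ξ i ≤ d / 128 := by
    intro ξ
    have h1 := sum_klDiv_historyLaw_single_le alg u τ hτ Δ (m ξ)
      (fun i => Function.update (m ξ) i 0) (m ξ)
      (fun i => by simp only [hm, mul_pow, boolSign_sq, one_mul])
      (fun i => by
        ext j
        rcases eq_or_ne j i with rfl | h
        · simp
        · simp [h]) T
    have h2 := sum_toReal_le_of_sum_le_ofReal (by positivity) h1
    refine ⟨h2.1, h2.2.trans ?_⟩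
    rw [← mul_div_assoc, div_le_iff₀ (by positivity)]
    linarith
  -- With coordinate `i` set to zero the law no longer depends on `ξ i`. Flipping this sign pairs up
  -- the sign vectors, and the two events of a pair are disjoint under one law, so the average is at
  -- most `1/2`.
  have hpair : ∀ t i, ∑ ξ, (H (Function.update (m ξ) i 0)).real (S t i (ξ i)) ≤
      (Fintype.card (Fin d → Bool) : ℝ) / 2 := by
    intro t i
    set e : (Fin d → Bool) → (Fin d → Bool) := fun ξ => Function.update ξ i (!ξ i) with he
    have hinv : Function.Involutive e := by
      intro ξ
      ext j
      rcases eq_or_ne j i with rfl | h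
      · simp [he]
      · simp [he, h]
    have hflip := Equiv.sum_comp hinv.toPerm
      fun ξ => (H (Function.update (m ξ) i 0)).real (S t i (ξ i))
    have hle : ∑ ξ, ((H (Function.update (m ξ) i 0)).real (S t i (ξ i)) +
        (H (Function.update (m (e ξ)) i 0)).real (S t i (e ξ i))) ≤
        ∑ _ξ : Fin d → Bool, (1 : ℝ) := by
      refine Finset.sum_le_sum fun ξ _ => ?_
      have h1 : Function.update (m (e ξ)) i 0 = Function.update (m ξ) i 0 := by
        ext j
        rcases eq_or_ne j i with rfl | h
        · simp
        · simp [hm, he, h]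
      have h2 : e ξ i = !ξ i := by simp [he]
      rw [h1, h2, ← measureReal_union _ (hSm t i _)]
      · exact measureReal_le_one
      · refine Set.disjoint_left.2 fun h ha hb => ?_
        simp only [hS, Set.mem_ofPred_eq, boolSign_not] at ha hb
        linarith
    rw [Finset.sum_add_distrib] at hle
    simp only [Function.Involutive.coe_toPerm] at hflip
    rw [hflip, Finset.sum_const, nsmul_eq_mul, mul_one, Finset.card_univ] at hle
    linarith
  -- Here `5/4 * 1/2 + 5 * 1/128 ≤ 27/40`, a fraction small enough that the truncation factor `10/9`
  -- brings it to `3/4`.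
  have htotal : ∑ ξ, ∑ t, ∑ i, (H (m ξ)).real (S t i (ξ i)) ≤
      ∑ _ξ : Fin d → Bool, (27 / 40 * (d * T) : ℝ) := by
    calc ∑ ξ, ∑ t, ∑ i, (H (m ξ)).real (S t i (ξ i))
        ≤ ∑ ξ, ∑ t : Fin T, ∑ i, (5 / 4 * (H (Function.update (m ξ) i 0)).real (S t i (ξ i)) +
            5 * K ξ i) := by
          gcongr with ξ _ t _ i _
          exact measureReal_le_add_klDiv _ _ ((hKL ξ).1 i) _
      _ = 5 / 4 * ∑ t : Fin T, ∑ i, ∑ ξ, (H (Function.update (m ξ) i 0)).real (S t i (ξ i)) +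
            5 * ∑ ξ, ∑ _t : Fin T, ∑ i, K ξ i := by
          simp only [Finset.sum_add_distrib, Finset.mul_sum]
          congr 1
          rw [Finset.sum_comm]
          exact Finset.sum_congr rfl fun t _ => Finset.sum_comm
      _ ≤ 5 / 4 * ∑ _t : Fin T, ∑ _i : Fin d, (Fintype.card (Fin d → Bool) : ℝ) / 2 +
            5 * ∑ _ξ : Fin d → Bool, ∑ _t : Fin T, (d / 128 : ℝ) := by
          gcongr with t _ i _ ξ _ t _
          · exact hpair t i
          · exact (hKL ξ).2
      _ ≤ _ := by
          simp only [Finset.sum_const, Finset.card_univ, Fintype.card_fin, nsmul_eq_mul]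
          have : (0 : ℝ) ≤ (Fintype.card (Fin d → Bool) : ℝ) * (d * T) := by positivity
          linarith
  obtain ⟨ξ, _, hξ⟩ := Finset.exists_le_of_sum_le Finset.univ_nonempty htotal
  exact ⟨ξ, hξ⟩

/-- For some coordinate and sign, the algorithm misses the only nonzero coordinate of the mean with
constant probability. -/
lemma exists_single_sum_measureReal_le (alg : BanditAlgorithm A) (hd : 1 ≤ d) (u τ Δ : ℝ)
    (hτ : 0 < τ) (T : ℕ) (hΔ : T * Δ ^ 2 ≤ τ ^ 2 * d / 64)
    (hA : ∀ a ∈ A, ∀ i j, i ≠ j → 3 / 4 ≤ |a i| → ¬ 3 / 4 ≤ |a j|) :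
    ∃ (j : Fin d) (b : Bool), ∑ t : Fin T,
      (historyLaw alg (noisyLaw (gaussianReal 0 1) u τ (Pi.single j (boolSign b * Δ))) T).real
        {h | 3 / 4 ≤ boolSign b * ((h t).1 : Fin d → ℝ) j} ≤ 27 / 40 * T := by
  set H : (Fin d → ℝ) → Measure (Fin T → A × ℝ) :=
    fun m => historyLaw alg (noisyLaw (gaussianReal 0 1) u τ m) T with hH
  set m : Fin d × Bool → Fin d → ℝ := fun x => Pi.single x.1 (boolSign x.2 * Δ) with hm
  set S : Fin T → Fin d × Bool → Set (Fin T → A × ℝ) :=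
    fun t x => {h | 3 / 4 ≤ boolSign x.2 * ((h t).1 : Fin d → ℝ) x.1} with hS
  have hSm : ∀ t x, MeasurableSet (S t x) := by
    intro t x
    refine measurableSet_le measurable_const (Measurable.const_mul ?_ _)
    exact (measurable_pi_apply x.1).comp
      (measurable_subtype_coe.comp (measurable_fst.comp (measurable_pi_apply t)))
  -- The zero mean now is the fixed first argument, so the change of measure is needed in the
  -- reverse direction.
  set K : Fin d × Bool → ℝ := fun x => (klDiv (H 0) (H (m x))).toReal with hK
  have hKL : ∀ b, (∀ j, klDiv (H 0) (H (m (j, b))) ≠ ⊤) ∧ ∑ j, K (j, b) ≤ d / 128 := by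
    intro b
    have h1 := sum_klDiv_historyLaw_single_le alg u τ hτ Δ 0
      (fun j => m (j, b)) (fun _ => -(boolSign b * Δ))
      (fun i => by simp only [neg_sq, mul_pow, boolSign_sq, one_mul])
      (fun i => by rw [zero_sub, hm, Pi.single_neg]) T
    have h2 := sum_toReal_le_of_sum_le_ofReal (by positivity) h1
    refine ⟨h2.1, h2.2.trans ?_⟩
    rw [← mul_div_assoc, div_le_iff₀ (by positivity)]
    linarith
  -- The `2 * d` events are disjoint under the law of mean zero. The two signs keep their average
  -- probability at most `1/2` even when `d = 1`.
  have hdisj : ∀ t, ∑ x, (H 0).real (S t x) ≤ 1 := by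
    intro t
    rw [← measureReal_biUnion_finset (fun x _ y _ hxy => ?_) fun x _ => hSm t x]
    · exact measureReal_le_one
    · refine Set.disjoint_left.2 fun h hx hy => ?_
      simp only [hS, Set.mem_ofPred_eq] at hx hy
      rcases eq_or_ne x.1 y.1 with h1 | h1
      · have h2 : y.2 = !x.2 := by
          rcases x with ⟨x1, x2⟩
          rcases y with ⟨y1, y2⟩
          simp only at h1
          subst h1
          cases x2 <;> cases y2 <;> simp_all
        rw [h2, boolSign_not, ← h1] at hy
        linarith
      · have habs : ∀ x : Fin d × Bool, boolSign x.2 * ((h t).1 : Fin d → ℝ) x.1 ≤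
            |((h t).1 : Fin d → ℝ) x.1| := fun x => by
          refine (le_abs_self _).trans ?_
          rw [abs_mul, abs_boolSign, one_mul]
        exact hA _ (h t).1.2 _ _ h1 (hx.trans (habs x)) (hy.trans (habs y))
  have hd' : (1 : ℝ) ≤ d := by exact_mod_cast hd
  have htotal : ∑ x, ∑ t, (H (m x)).real (S t x) ≤
      ∑ _x : Fin d × Bool, (27 / 40 * T : ℝ) := by
    calc ∑ x, ∑ t, (H (m x)).real (S t x)
        ≤ ∑ x, ∑ t : Fin T, (5 / 4 * (H 0).real (S t x) + 5 * K x) := by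
          gcongr with x _ t _
          exact measureReal_le_add_klDiv' _ _ ((hKL x.2).1 x.1) _
      _ = 5 / 4 * ∑ t : Fin T, ∑ x, (H 0).real (S t x) +
            5 * (T * ∑ b, ∑ j, K (j, b)) := by
          simp only [Finset.sum_add_distrib, Finset.sum_const, Finset.card_univ, Fintype.card_fin,
            nsmul_eq_mul, ← Finset.mul_sum]
          rw [Finset.sum_comm (f := fun x t => (H 0).real (S t x)), Fintype.sum_prod_type_right]
          ring
      _ ≤ 5 / 4 * ∑ _t : Fin T, (1 : ℝ) + 5 * (T * ∑ _b : Bool, (d / 128 : ℝ)) := by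
          gcongr with t _ b _
          · exact hdisj t
          · exact (hKL b).2
      _ ≤ _ := by
          simp only [Finset.sum_const, Finset.card_univ, Fintype.card_fin, nsmul_eq_mul,
            Fintype.card_prod, Fintype.card_bool]
          push_cast
          have : (T : ℝ) ≤ d * T := le_mul_of_one_le_left (Nat.cast_nonneg _) hd'
          linarith
  have : Nonempty (Fin d) := ⟨⟨0, hd⟩⟩
  obtain ⟨x, _, hx⟩ := Finset.exists_le_of_sum_le Finset.univ_nonempty htotal
  exact ⟨x.1, x.2, hx⟩

end Averaging

/-! ### The two hard families with truncated noise -/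

section LowerBound

variable {d T : ℕ} {p q : ℝ}

/-- The noise model with truncated Gaussian noise, tuned so that every coordinate has variance
`ρ ^ 2` with `ρ = √σsq * d ^ (-1 / q)`. -/
noncomputable def hardLaw (κ ρ L : ℝ) (m : Fin d → ℝ) : Measure (Fin d → ℝ) :=
  noisyLaw (truncGaussian L) √(ρ ^ 2 - (κ * ρ / L) ^ 2 * ∫ x, x ^ 2 ∂truncGaussian L) (κ * ρ / L) m

lemma isProbabilityMeasure_hardLaw {κ ρ L : ℝ} (hL : 2 ≤ L) (m : Fin d → ℝ) :
    IsProbabilityMeasure (hardLaw κ ρ L m) := by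
  have := isProbabilityMeasure_truncGaussian hL
  exact noisyLaw.instIsProbabilityMeasure _ _ _ _

/-- Makes the square root in `hardLaw` genuine, so that the variance is exactly `ρ ^ 2`. -/
lemma hardLaw_variance_gap {κ ρ L : ℝ} (hL : 2 ≤ L) (hκ0 : 0 < κ) (hκ1 : κ ≤ 1) :
    0 ≤ ρ ^ 2 - (κ * ρ / L) ^ 2 * ∫ x, x ^ 2 ∂truncGaussian L := by
  have h1 : (κ * ρ / L) ^ 2 * ∫ x, x ^ 2 ∂truncGaussian L ≤ (κ * ρ / L) ^ 2 * L ^ 2 :=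
    mul_le_mul_of_nonneg_left (integral_sq_truncGaussian_le hL) (sq_nonneg _)
  have h2 : (κ * ρ / L) ^ 2 * L ^ 2 = κ ^ 2 * ρ ^ 2 := by
    have : L ≠ 0 := by linarith
    field_simp
  have h3 : κ ^ 2 * ρ ^ 2 ≤ 1 * ρ ^ 2 :=
    mul_le_mul_of_nonneg_right (pow_le_one₀ hκ0.le hκ1) (sq_nonneg _)
  linarith

lemma sigmaSq_hardLaw {κ L σsq : ℝ} (hL : 2 ≤ L) (hκ0 : 0 < κ) (hκ1 : κ ≤ 1) (hd : 1 ≤ d)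
    (hq : 0 < q) (hσ : 0 < σsq) (m : Fin d → ℝ) :
    sigmaSq q (hardLaw κ (√σsq * (d : ℝ) ^ (-(1 / q))) L m) = σsq := by
  have := isProbabilityMeasure_truncGaussian hL
  have hd' : (0 : ℝ) < d := by exact_mod_cast hd
  have hcov : ∀ i, covMatrix (hardLaw κ (√σsq * (d : ℝ) ^ (-(1 / q))) L m) i i =
      σsq * (d : ℝ) ^ (-(2 / q)) := by
    intro i
    rw [hardLaw, covMatrix_noisyLaw_diag ae_truncGaussian_abs_le integral_truncGaussian,
      Real.sq_sqrt (hardLaw_variance_gap hL hκ0 hκ1), sub_add_cancel, mul_pow,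
      Real.sq_sqrt hσ.le, ← Real.rpow_natCast, ← Real.rpow_mul hd'.le]
    congr 2
    push_cast
    ring
  simp only [sigmaSq, hcov, Finset.sum_const, Finset.card_univ, Fintype.card_fin, nsmul_eq_mul]
  rw [Real.mul_rpow hσ.le (by positivity), ← Real.rpow_mul hd'.le,
    show -(2 / q) * (q / 2) = -1 by field_simp, Real.rpow_neg_one, mul_comm, mul_assoc,
    inv_mul_cancel₀ hd'.ne', mul_one, ← Real.rpow_mul hσ.le,
    show q / 2 * (2 / q) = 1 by field_simp, Real.rpow_one]

lemma ae_hardLaw_abs_le {κ ρ L : ℝ} (hL : 2 ≤ L) (hκ0 : 0 < κ) (hρ : 0 ≤ ρ)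
    {m : Fin d → ℝ} (hm : ∀ i, |m i| ≤ κ * ρ) :
    ∀ᵐ θ ∂(hardLaw κ ρ L m), ∀ i, |θ i| ≤ (1 + 2 * κ) * ρ := by
  have := isProbabilityMeasure_truncGaussian hL
  have hL0 : 0 < L := by linarith
  have hu : √(ρ ^ 2 - (κ * ρ / L) ^ 2 * ∫ x, x ^ 2 ∂truncGaussian L) ≤ ρ := by
    rw [Real.sqrt_le_left hρ]
    have : 0 ≤ (κ * ρ / L) ^ 2 * ∫ x, x ^ 2 ∂truncGaussian L :=
      mul_nonneg (sq_nonneg _) (integral_nonneg fun x => sq_nonneg x)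
    linarith
  filter_upwards [ae_noisyLaw_bound ae_truncGaussian_abs_le _ (κ * ρ / L) m] with θ hθ i
  have h1 := hθ i
  rw [abs_of_nonneg (Real.sqrt_nonneg _), abs_of_nonneg (by positivity : 0 ≤ κ * ρ / L),
    div_mul_cancel₀ _ hL0.ne'] at h1
  linarith [hm i]

/-- The scale of the regret at the gap used in the lower bound. -/
lemma gap_mul_rpow_eq {κ L σsq : ℝ} (hd : 1 ≤ d) :
    κ * (√σsq * (d : ℝ) ^ (-(1 / q))) / L / 8 * √(d / T) * T * (d : ℝ) ^ (1 / q) =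
      κ / (8 * L) * √(d * T * σsq) := by
  have hd' : (0 : ℝ) < d := by exact_mod_cast hd
  have h1 : (d : ℝ) ^ (-(1 / q)) * (d : ℝ) ^ (1 / q) = 1 := by rw [← Real.rpow_add hd']; simp
  have h2 : √((d : ℝ) / T) * T = √(d * T) := by
    rw [Real.sqrt_div hd'.le, Real.sqrt_mul hd'.le, div_mul_eq_mul_div, mul_div_assoc,
      Real.div_sqrt]
  rw [Real.sqrt_mul (by positivity) σsq, ← h2]
  linear_combination (κ * √σsq / L / 8 * √((d : ℝ) / T) * T) * h1

/-- The lower bound for means with all coordinates equal up to signs. -/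
lemma exists_signs_le_expectedRegret (hp : 1 < p) (hpq : p.HolderConjugate q) (hd : 1 ≤ d)
    (hdT : d ≤ T) (alg : BanditAlgorithm (lpUnitBall d p)) {κ ρ L : ℝ} (hκ : 0 < κ) (hρ : 0 < ρ)
    (hL : L = √(8 * (1 + Real.log T))) (hL2 : 2 ≤ L) {Δ : ℝ}
    (hΔ : Δ = κ * ρ / L / 8 * √(d / T)) :
    ∃ m : Fin d → ℝ, (∀ i, |m i| ≤ Δ) ∧ ∃ aStar : Fin d → ℝ,
      IsBestAction (lpUnitBall d p) (hardLaw κ ρ L m) aStar ∧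
      Δ * T * (d : ℝ) ^ (1 / q) / (4 * q) ≤ expectedRegret alg (hardLaw κ ρ L m) aStar T := by
  have := isProbabilityMeasure_truncGaussian hL2
  have hd' : (0 : ℝ) < d := by exact_mod_cast hd
  have hT : (0 : ℝ) < T := by exact_mod_cast hd.trans hdT
  have hL0 : 0 < L := by linarith
  have hΔ0 : 0 ≤ Δ := by rw [hΔ]; positivity
  have hq : 1 < q := hpq.symm.lt
  have hgap : T * Δ ^ 2 ≤ (κ * ρ / L) ^ 2 * d / 64 := by
    rw [hΔ, mul_pow, Real.sq_sqrt (by positivity)]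
    refine le_of_eq ?_
    field_simp
    norm_num
  obtain ⟨ξ, hξ⟩ := exists_signs_sum_measureReal_le alg
    √(ρ ^ 2 - (κ * ρ / L) ^ 2 * ∫ x, x ^ 2 ∂truncGaussian L) (κ * ρ / L) Δ (by positivity) T hgap
  set m : Fin d → ℝ := fun i => boolSign (ξ i) * Δ with hm
  have hmean : meanVector (hardLaw κ ρ L m) = m :=
    meanVector_noisyLaw ae_truncGaussian_abs_le integral_truncGaussian _ _ _
  -- The equality case of Hölder: correct signs and equal weights on the unit sphere.
  set aStar : Fin d → ℝ := fun i => boolSign (ξ i) * (d : ℝ) ^ (-(1 / p)) with haS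
  have hpow : (d : ℝ) * (d : ℝ) ^ (-(1 / p)) = (d : ℝ) ^ (1 / q) := by
    have h1 : 1 / q = 1 + -(1 / p) := by
      have := hpq.inv_add_inv_eq_one
      simp only [one_div]
      linarith
    rw [h1, Real.rpow_add hd', Real.rpow_one]
  have hval : aStar ⬝ᵥ m = Δ * (d : ℝ) ^ (1 / q) := by
    have : ∀ i, aStar i * m i = Δ * (d : ℝ) ^ (-(1 / p)) := by
      intro i
      simp only [haS, hm]
      linear_combination (Δ * (d : ℝ) ^ (-(1 / p))) * boolSign_sq (ξ i)
    simp only [dotProduct, this, Finset.sum_const, Finset.card_univ, Fintype.card_fin,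
      nsmul_eq_mul]
    rw [← hpow]
    ring
  have hle : ∀ a ∈ lpUnitBall d p, a ⬝ᵥ m ≤
      Δ * ((Finset.univ.filter fun i => 0 < boolSign (ξ i) * a i).card : ℝ) ^ (1 / q) := by
    intro a ha
    calc a ⬝ᵥ m = Δ * ∑ i, boolSign (ξ i) * a i := by
          rw [dotProduct, Finset.mul_sum]
          exact Finset.sum_congr rfl fun i _ => by simp only [hm]; ring
      _ ≤ Δ * ∑ i ∈ Finset.univ.filter (fun i => 0 < boolSign (ξ i) * a i), |a i| := by
          rw [Finset.sum_filter]
          gcongr with i _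
          split_ifs with h
          · refine (le_abs_self _).trans ?_
            rw [abs_mul, abs_boolSign, one_mul]
          · exact not_lt.1 h
      _ ≤ _ := by
          gcongr
          exact sum_abs_le_card_rpow hp hpq ha _
  refine ⟨m, fun i => ?_, aStar, ⟨?_, fun a ha => ?_⟩, ?_⟩
  · simp [hm, abs_mul, abs_boolSign, abs_of_nonneg hΔ0]
  · refine mem_lpUnitBall_of_sum_rpow_le_one hp (le_of_eq ?_)
    have : ∀ i, |aStar i| ^ p = (d : ℝ)⁻¹ := by
      intro i
      simp only [haS]
      rw [abs_mul, abs_boolSign, one_mul, abs_of_nonneg (by positivity), ← Real.rpow_mul hd'.le,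
        show -(1 / p) * p = -1 by field_simp, Real.rpow_neg_one]
    simp only [this, Finset.sum_const, Finset.card_univ, Fintype.card_fin, nsmul_eq_mul]
    exact mul_inv_cancel₀ hd'.ne'
  · rw [hmean, hval]
    refine (hle a ha).trans ?_
    gcongr
    simpa using Finset.card_filter_le (Finset.univ : Finset (Fin d)) _
  · have := isProbabilityMeasure_hardLaw (κ := κ) (ρ := ρ) hL2 m
    have hB := le_expectedRegret alg (hardLaw κ ρ L m) aStar T (Δ * (d : ℝ) ^ (1 / q) / q) (1 / d)
      (3 / 4 * T) (fun i : Fin d => {a | 0 < boolSign (ξ i) * a i})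
      (fun i => measurableSet_lt measurable_const ((measurable_pi_apply i).const_mul _))
      (fun a ha i => abs_le_one_of_mem_lpUnitBall hp ha i) (fun a ha => ?_) (by positivity) ?_
    · refine le_trans (le_of_eq ?_) hB
      field_simp
      ring
    · rw [hmean, sub_dotProduct, hval]
      have hN : ∑ i, ({a : Fin d → ℝ | 0 < boolSign (ξ i) * a i}).indicator (1 : (Fin d → ℝ) → ℝ) a =
          ((Finset.univ.filter fun i => 0 < boolSign (ξ i) * a i).card : ℝ) := by
        rw [Finset.card_filter]
        push_cast
        exact Finset.sum_congr rfl fun i _ => by simp [Set.indicator_apply]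
      rw [hN]
      have h1 := mul_le_mul_of_nonneg_left (rpow_one_div_le_tangent hq.le
        (Nat.cast_nonneg (Finset.univ.filter fun i => 0 < boolSign (ξ i) * a i).card) hd') hΔ0
      have h2 := hle a ha
      have h3 : Δ * ((d : ℝ) ^ (1 / q) *
          (1 - (1 - ((Finset.univ.filter fun i => 0 < boolSign (ξ i) * a i).card : ℝ) / d) / q)) =
          Δ * (d : ℝ) ^ (1 / q) - Δ * (d : ℝ) ^ (1 / q) / q * (1 - 1 / d *
            ((Finset.univ.filter fun i => 0 < boolSign (ξ i) * a i).card : ℝ)) := by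
        ring
      linarith
    -- Since `10/9 * 27/40 = 3/4`, a quarter of the signs is missed on average, whence the factor `1
    -- / (4 * q)`.
    · calc _ ≤ 1 / (d : ℝ) * (10 / 9 * (27 / 40 * (d * T))) := by
            gcongr
            refine le_trans ?_ (mul_le_mul_of_nonneg_left hξ (by norm_num))
            rw [Finset.mul_sum]
            refine Finset.sum_le_sum fun t _ => ?_
            rw [Finset.mul_sum]
            exact Finset.sum_le_sum fun i _ =>
              historyLaw_truncGaussian_real_le alg hd hdT hL _ _ _ _
        _ = _ := by field_simp; norm_num

/-- The lower bound for means with a single nonzero coordinate. -/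
lemma exists_single_le_expectedRegret (hp : 1 < p) (hp2 : p ≤ 2) (hd : 1 ≤ d)
    (hdT : d ≤ T) (alg : BanditAlgorithm (lpUnitBall d p)) {κ ρ L : ℝ} (hκ : 0 < κ) (hρ : 0 < ρ)
    (hL : L = √(8 * (1 + Real.log T))) (hL2 : 2 ≤ L) {Δ : ℝ}
    (hΔ : Δ = κ * ρ / L / 8 * √(d / T)) :
    ∃ m : Fin d → ℝ, (∀ i, |m i| ≤ Δ) ∧ ∃ aStar : Fin d → ℝ,
      IsBestAction (lpUnitBall d p) (hardLaw κ ρ L m) aStar ∧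
      Δ * T / 16 ≤ expectedRegret alg (hardLaw κ ρ L m) aStar T := by
  have := isProbabilityMeasure_truncGaussian hL2
  have hd' : (0 : ℝ) < d := by exact_mod_cast hd
  have hT : (0 : ℝ) < T := by exact_mod_cast hd.trans hdT
  have hL0 : 0 < L := by linarith
  have hΔ0 : 0 ≤ Δ := by rw [hΔ]; positivity
  have hgap : T * Δ ^ 2 ≤ (κ * ρ / L) ^ 2 * d / 64 := by
    rw [hΔ, mul_pow, Real.sq_sqrt (by positivity)]
    refine le_of_eq ?_
    field_simp
    norm_num
  -- Two such entries would give `2 * (3/4)^p ≥ 9/8 > 1`; this is where `p ≤ 2` is needed.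
  have hA : ∀ a ∈ lpUnitBall d p, ∀ i j, i ≠ j → 3 / 4 ≤ |a i| → ¬ 3 / 4 ≤ |a j| := by
    intro a ha i j hij hi hj
    have hlow : ∀ k, 3 / 4 ≤ |a k| → 9 / 16 ≤ |a k| ^ p := by
      intro k hk
      calc (9 / 16 : ℝ) = (3 / 4) ^ (2 : ℝ) := by norm_num
        _ ≤ (3 / 4) ^ p := Real.rpow_le_rpow_of_exponent_ge (by norm_num) (by norm_num) hp2
        _ ≤ |a k| ^ p := Real.rpow_le_rpow (by norm_num) hk (by linarith)
    have h1 := Finset.sum_le_sum_of_subset_of_nonneg (Finset.subset_univ {i, j})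
      (f := fun k => |a k| ^ p) fun k _ _ => by positivity
    rw [Finset.sum_pair hij] at h1
    linarith [sum_rpow_le_one_of_mem_lpUnitBall hp ha, hlow i hi, hlow j hj]
  obtain ⟨j, b, hjb⟩ := exists_single_sum_measureReal_le alg hd
    √(ρ ^ 2 - (κ * ρ / L) ^ 2 * ∫ x, x ^ 2 ∂truncGaussian L) (κ * ρ / L) Δ (by positivity) T hgap hA
  set m : Fin d → ℝ := Pi.single j (boolSign b * Δ) with hm
  have hmean : meanVector (hardLaw κ ρ L m) = m :=
    meanVector_noisyLaw ae_truncGaussian_abs_le integral_truncGaussian _ _ _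
  have hdot : ∀ a : Fin d → ℝ, a ⬝ᵥ m = Δ * (boolSign b * a j) := by
    intro a
    rw [hm, dotProduct_single]
    ring
  have hval : Pi.single j (boolSign b) ⬝ᵥ m = Δ := by
    rw [hdot, Pi.single_eq_same, ← sq, boolSign_sq, mul_one]
  refine ⟨m, fun i => ?_, Pi.single j (boolSign b), ⟨?_, fun a ha => ?_⟩, ?_⟩
  · rcases eq_or_ne i j with rfl | h
    · simp [hm, abs_mul, abs_boolSign, abs_of_nonneg hΔ0]
    · simp [hm, h, hΔ0]
  · refine mem_lpUnitBall_of_sum_rpow_le_one hp (le_of_eq ?_)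
    rw [Finset.sum_eq_single j]
    · simp [abs_boolSign]
    · intro i _ h
      simp [h, Real.zero_rpow (by linarith : p ≠ 0)]
    · simp
  · rw [hmean, hval, hdot]
    refine mul_le_of_le_one_right hΔ0 ((le_abs_self _).trans ?_)
    rw [abs_mul, abs_boolSign, one_mul]
    exact abs_le_one_of_mem_lpUnitBall hp ha j
  · have := isProbabilityMeasure_hardLaw (κ := κ) (ρ := ρ) hL2 m
    -- An action outside the event loses at least `Δ / 4`, and this happens in at least a quarter of
    -- the rounds on average: together `Δ * T / 16`.
    have hB := le_expectedRegret alg (hardLaw κ ρ L m) (Pi.single j (boolSign b)) T (Δ / 4) 1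
      (3 / 4 * T) (fun _ : Unit => {a | 3 / 4 ≤ boolSign b * a j})
      (fun i => measurableSet_le measurable_const ((measurable_pi_apply j).const_mul _))
      (fun a ha i => abs_le_one_of_mem_lpUnitBall hp ha i) (fun a ha => ?_) (by positivity) ?_
    · refine le_trans (le_of_eq ?_) hB
      ring
    · rw [hmean, sub_dotProduct, hval, hdot]
      have h1 : boolSign b * a j ≤ 1 := by
        refine (le_abs_self _).trans ?_
        rw [abs_mul, abs_boolSign, one_mul]
        exact abs_le_one_of_mem_lpUnitBall hp ha j
      by_cases h : 3 / 4 ≤ boolSign b * a j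
      · have : ∑ _i : Unit, ({a : Fin d → ℝ | 3 / 4 ≤ boolSign b * a j}).indicator
            (1 : (Fin d → ℝ) → ℝ) a = 1 := by simp [h]
        rw [this]
        nlinarith
      · have : ∑ _i : Unit, ({a : Fin d → ℝ | 3 / 4 ≤ boolSign b * a j}).indicator
            (1 : (Fin d → ℝ) → ℝ) a = 0 := by simp [h]
        rw [this]
        nlinarith
    · rw [one_mul]
      simp only [Finset.univ_unique, Finset.sum_singleton]
      calc _ ≤ 10 / 9 * (27 / 40 * (T : ℝ)) := by
            refine le_trans ?_ (mul_le_mul_of_nonneg_left hjb (by norm_num))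
            rw [Finset.mul_sum]
            exact Finset.sum_le_sum fun t _ =>
              historyLaw_truncGaussian_real_le alg hd hdT hL _ _ _ _
        _ = _ := by ring

/-- For such `q`, `log d / q ≤ 1/2 < log 2`. This is why hiding one coordinate is enough for large
`q`. -/
lemma rpow_one_div_le_two {l : ℝ} (hd : 1 ≤ d) (hdT : d ≤ T) (hl : l = Real.log T)
    (hq : 2 * (1 + l) < q) : (d : ℝ) ^ (1 / q) ≤ 2 := by
  have hd' : (0 : ℝ) < d := by exact_mod_cast hd
  have hl0 : 0 ≤ l := by rw [hl]; exact Real.log_nonneg (by exact_mod_cast hd.trans hdT)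
  have hlog : Real.log d ≤ l := by
    rw [hl]; exact Real.log_le_log hd' (by exact_mod_cast hdT)
  rw [Real.rpow_def_of_pos hd', ← Real.le_log_iff_exp_le (by norm_num)]
  have h1 : Real.log d * (1 / q) ≤ 1 / 2 := by
    rw [mul_one_div, div_le_div_iff₀ (by linarith) (by norm_num)]
    linarith
  linarith [Real.log_two_gt_d9]

end LowerBound

/-! ### Choice of constants and conclusion -/

theorem mainTheorem5 :
    ∃ k : ℕ, ∀ s : ℝ, s < 1 → ∃ c : ℝ, 0 < c ∧
      ∀ (p q : ℝ), 1 < p → p ≤ 2 → p.HolderConjugate q →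
      ∀ (d T : ℕ), 1 ≤ d → d ≤ T →
      ∀ (σsq : ℝ), 0 < σsq →
      ∀ alg : BanditAlgorithm (lpUnitBall d p),
        ∃ ν : Measure (Fin d → ℝ), IsProbabilityMeasure ν ∧
          (∀ i, MemLp (fun θ : Fin d → ℝ => θ i) 2 ν) ∧
          sigmaSq q ν = σsq ∧
          (σsq ≤ s → ∀ᵐ θ ∂ν, ∀ a ∈ lpUnitBall d p, |a ⬝ᵥ θ| ≤ 1) ∧
          ∃ aStar : Fin d → ℝ, IsBestAction (lpUnitBall d p) ν aStar ∧
            c * Real.sqrt (d * T * σsq) / (1 + Real.log T) ^ k ≤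
              expectedRegret alg ν aStar T := by
  -- One power of the logarithm pays for `L ≤ 3 * (1 + log T)`, the other for `1 / q` when `q ≤ 2 *
  -- (1 + log T)`.
  refine ⟨2, fun s hs => ?_⟩
  have hs1 : √s < 1 := by rw [Real.sqrt_lt' one_pos]; simpa using hs
  have hs0 := Real.sqrt_nonneg s
  -- The coordinates of `θ` are at most `(1 + 2 * κ) * ρ`, from mean, sign and Gaussian part. As `√s
  -- = 1 - 2 * κ`, the product `(1 + 2 * κ) * √s` is at most 1.
  obtain ⟨κ, hκ⟩ : ∃ κ, κ = (1 - √s) / 2 := ⟨_, rfl⟩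
  have hκ0 : 0 < κ := by linarith
  have hκ1 : κ ≤ 1 := by linarith
  -- `768 = 8 * 3 * 32` comes from the single-coordinate family; the sign family only needs `8 * 3 *
  -- 4 * 2`.
  refine ⟨κ / 768, by positivity, fun p q hp hp2 hpq d T hd hdT σsq hσ alg => ?_⟩
  have hd' : (1 : ℝ) ≤ d := by exact_mod_cast hd
  have hdT' : (d : ℝ) ≤ T := by exact_mod_cast hdT
  have hT : (0 : ℝ) < T := by linarith
  have hq : 1 < q := hpq.symm.lt
  obtain ⟨l, hl⟩ : ∃ l, l = Real.log T := ⟨_, rfl⟩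
  have hl0 : 0 ≤ l := by rw [hl]; exact Real.log_nonneg (by linarith)
  obtain ⟨L, hL⟩ : ∃ L, L = √(8 * (1 + Real.log T)) := ⟨_, rfl⟩
  have hLsq : L ^ 2 = 8 * (1 + l) := by rw [hL, ← hl, Real.sq_sqrt (by positivity)]
  have hL2 : 2 ≤ L := by
    rw [hL, ← hl]; exact Real.le_sqrt_of_sq_le (by linarith)
  have hL3 : L ≤ 3 * (1 + l) := by nlinarith
  have := isProbabilityMeasure_truncGaussian hL2
  obtain ⟨ρ, hρ⟩ : ∃ ρ, ρ = √σsq * (d : ℝ) ^ (-(1 / q)) := ⟨_, rfl⟩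
  have hρ0 : 0 < ρ := by rw [hρ]; positivity
  obtain ⟨Δ, hΔ⟩ : ∃ Δ, Δ = κ * ρ / L / 8 * √(d / T) := ⟨_, rfl⟩
  have hΔκ : Δ ≤ κ * ρ := by
    have h1 : √((d : ℝ) / T) ≤ 1 := by
      rw [Real.sqrt_le_one, div_le_one hT]; exact hdT'
    calc Δ = κ * ρ * (1 / (8 * L)) * √((d : ℝ) / T) := by rw [hΔ]; field_simp
      _ ≤ κ * ρ * 1 * 1 := by
        gcongr
        rw [div_le_one (by linarith)]
        linarith
      _ = _ := by ring
  have hscale : Δ * T * (d : ℝ) ^ (1 / q) = κ / (8 * L) * √(d * T * σsq) := by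
    rw [hΔ, hρ]
    exact gap_mul_rpow_eq hd
  suffices h : ∃ m : Fin d → ℝ, (∀ i, |m i| ≤ Δ) ∧ ∃ aStar : Fin d → ℝ,
      IsBestAction (lpUnitBall d p) (hardLaw κ ρ L m) aStar ∧
      κ / 768 * √(d * T * σsq) / (1 + l) ^ 2 ≤
        expectedRegret alg (hardLaw κ ρ L m) aStar T by
    obtain ⟨m, hm, aStar, hbest, hreg⟩ := h
    refine ⟨hardLaw κ ρ L m, isProbabilityMeasure_hardLaw hL2 m,
      memLp_noisyLaw ae_truncGaussian_abs_le _ _ _, ?_, fun hσs => ?_, aStar, hbest, ?_⟩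
    · rw [hρ]
      exact sigmaSq_hardLaw hL2 hκ0 hκ1 hd (by linarith) hσ m
    · filter_upwards [ae_hardLaw_abs_le hL2 hκ0 hρ0.le fun i => (hm i).trans hΔκ] with θ hθ a ha
      refine abs_dotProduct_le_one hp hpq hd ha fun i => (hθ i).trans ?_
      have h1 : √σsq ≤ 1 - 2 * κ := (Real.sqrt_le_sqrt hσs).trans (by linarith)
      have h2 : (1 + 2 * κ) * √σsq ≤ 1 := by nlinarith
      rw [hρ, ← mul_assoc]
      exact mul_le_of_le_one_left (by positivity) h2
    · rwa [← hl]
  have hR := Real.sqrt_nonneg ((d : ℝ) * T * σsq)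
  -- Below the threshold the loss `1 / q` is logarithmic; above it `d^(1/q)` is bounded.
  rcases le_or_gt q (2 * (1 + l)) with hql | hql
  · obtain ⟨m, hm, aStar, hbest, hreg⟩ :=
      exists_signs_le_expectedRegret hp hpq hd hdT alg hκ0 hρ0 hL hL2 hΔ
    refine ⟨m, hm, aStar, hbest, le_trans ?_ hreg⟩
    rw [hscale]
    calc κ / 768 * √(d * T * σsq) / (1 + l) ^ 2
        ≤ κ * √(d * T * σsq) / (8 * (3 * (1 + l)) * (4 * (2 * (1 + l)))) := by
          rw [div_mul_eq_mul_div, div_div]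
          refine div_le_div_of_nonneg_left (by positivity) (by positivity) ?_
          nlinarith
      _ ≤ κ * √(d * T * σsq) / (8 * L * (4 * q)) := by gcongr
      _ = _ := by field_simp
  · obtain ⟨m, hm, aStar, hbest, hreg⟩ :=
      exists_single_le_expectedRegret hp hp2 hd hdT alg hκ0 hρ0 hL hL2 hΔ
    refine ⟨m, hm, aStar, hbest, le_trans ?_ hreg⟩
    have h2 := rpow_one_div_le_two hd hdT hl hql
    have hΔT : 0 ≤ Δ * T := by rw [hΔ]; positivity
    have h3 : κ / (8 * L) * √(d * T * σsq) ≤ Δ * T * 2 := by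
      rw [← hscale]
      gcongr
    calc κ / 768 * √(d * T * σsq) / (1 + l) ^ 2
        ≤ κ * √(d * T * σsq) / (8 * (3 * (1 + l)) * 32) := by
          rw [div_mul_eq_mul_div, div_div]
          refine div_le_div_of_nonneg_left (by positivity) (by positivity) ?_
          nlinarith
      _ ≤ κ * √(d * T * σsq) / (8 * L * 32) := by gcongr
      _ = κ / (8 * L) * √(d * T * σsq) / 32 := by field_simp
      _ ≤ _ := by linarith
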